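/- Let $n\ge 1$. There is a constant $C$ depending only on $n$ such that the following holds. Let $\varepsilon_1,\dots,\varepsilon_n\in\{1,-1\}$, $\Delta_\pm=\sum_{i=1}^n\varepsilon_i\partial_{x_i}^2$, and let $F\in\mathcal S(\mathbb R\times\mathbb R^n)$ be complex-valued. Then the initial value problem $$(i\partial_t+\Delta_\pm)u=F(t,x),\qquad u(0,x)=0,$$ has a unique solution $u\in C(\mathbb R;L^2(\mathbb R^n))$ (the equation being understood in $\mathcal S'(\mathbb R^n)$ for every $t$, with the time derivative tested against Schwartz functions of $x$). For every $\mathbf e=(e_1,\dots,e_n)\in\mathbb R^n$ with $|\mathbf e|=1$, put $\mathbf e_\pm=(\varepsilon_1e_1,\dots,\varepsilon_ne_n)$ and let $D_{\mathbf e_\pm}$ be the operator in $x$ with Fourier multiplier $\xi\cdot\mathbf e_\pm$ (for the Fourier transform with kernel $e^{-ix\cdot\xi}$), that is, $D_{\mathbf e_\pm}=-i\,\mathbf e_\pm\cdot\nabla$. Then $D_{\mathbf e_\pm}u$ is given by a measurable function of $(t,x)$ that is square integrable in $x$ for each $t$, and $$\|D_{\mathbf e_\pm}u\|_{L^{\infty,2}_{\mathbf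 e}}\le C\,\|F\|_{L^{1,2}_{\mathbf e}},$$ where, with $P_{\mathbf e}=\{v\in\mathbb R^n: v\cdot\mathbf e=0\}$, $$\|g\|_{L^{p,q}_{\mathbf e}}=\Big[\int_{\mathbb R}\Big[\int_{P_{\mathbf e}\times\mathbb R}|g(t,r\mathbf e+v)|^q\,dv\,dt\Big]^{p/q}dr\Big]^{1/p},$$ with the essential supremum in $r$ when $p=\infty$. -/

import Mathlib

open MeasureTheory
open scoped ENNReal NNReal SchwartzMap

noncomputable section

namespace NonEllipticSchrodinger

/-- The space `ℝⁿ` with its Euclidean norm and Lebesgue measure. -/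
abbrev Space (n : ℕ) : Type := EuclideanSpace ℝ (Fin n)

/-- The operator `Δ_± w = ∑ᵢ εᵢ ∂ᵢ² w`, with distributional derivatives. -/
def signedLaplacian {n : ℕ} (ε : Fin n → ℝ) (w : 𝓢'(Space n, ℂ)) : 𝓢'(Space n, ℂ) :=
  ∑ i : Fin n, (ε i : ℂ) •
    LineDeriv.lineDerivOp (EuclideanSpace.single i (1 : ℝ))
      (LineDeriv.lineDerivOp (EuclideanSpace.single i (1 : ℝ)) w)

/-- The vector `e_± = (ε₁ e₁, …, εₙ eₙ)`. -/
def signedVector {n : ℕ} (ε : Fin n → ℝ) (e : Space n) : Space n :=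
  WithLp.toLp 2 (fun i => ε i * e i)

/-- The operator `D_a` with Fourier symbol `ξ · a`, for the convention
`f̂(ξ) = c ∫ exp(-i x · ξ) f(x) dx`. Mathlib's transform uses `exp(-2πi x · ξ)`, so its frequency
variable has to be multiplied by `2π`; the operator itself is `D_a = -i ∂_a`. -/
def directionalD {n : ℕ} (a : Space n) (w : 𝓢'(Space n, ℂ)) : 𝓢'(Space n, ℂ) :=
  TemperedDistribution.fourierMultiplierCLM ℂ
    (fun ξ : Space n => ((2 * Real.pi * inner ℝ ξ a : ℝ) : ℂ)) w

/-- `u ∈ C(ℝ; L²(ℝⁿ))` solves `(i∂ₜ + Δ_±) u = F`, `u(0) = 0`. The equation holds in `𝓢'(ℝⁿ)` at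
every time, the time derivative being the weak one (tested against Schwartz functions). -/
structure IsSolution {n : ℕ} (ε : Fin n → ℝ) (F : 𝓢(ℝ × Space n, ℂ))
    (u : ℝ → Lp ℂ 2 (volume : Measure (Space n))) : Prop where
  continuous : Continuous u
  initial : u 0 = 0
  differentiable : ∀ φ : 𝓢(Space n, ℂ),
    Differentiable ℝ (fun t : ℝ => Lp.toTemperedDistribution (u t) φ)
  equation : ∀ (φ : 𝓢(Space n, ℂ)) (t : ℝ),
    Complex.I * deriv (fun s : ℝ => Lp.toTemperedDistribution (u s) φ) t
      + signedLaplacian ε (Lp.toTemperedDistribution (u t)) φ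
      = ∫ x : Space n, φ x * F (t, x)

/-- The time-dependent distribution `w` is given by the function `g(t, x)`, which is
measurable on `ℝ × ℝⁿ` and square integrable in `x` at every time. -/
structure IsRepresentedBy {n : ℕ} (w : ℝ → 𝓢'(Space n, ℂ)) (g : ℝ → Space n → ℂ) : Prop where
  aestronglyMeasurable : AEStronglyMeasurable (fun z : ℝ × Space n => g z.1 z.2) volume
  memLp : ∀ t : ℝ, MemLp (g t) 2 volume
  pairing : ∀ (t : ℝ) (φ : 𝓢(Space n, ℂ)), w t φ = ∫ x : Space n, φ x * g t x

/-- The hyperplane `P_e = {ξ : ξ · e = 0}` (`volume` on it is Lebesgue measure of dimension `n - 1`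
when `e ≠ 0`). -/
abbrev hyperplane {n : ℕ} (e : Space n) : Submodule ℝ (Space n) := (ℝ ∙ e)ᗮ

/-- The norm of `L^{p,q}_e`: the `L^p` norm in `r ∈ ℝ` of the `L^q` norm in `(t, v) ∈ ℝ × P_e` of
`g(t, r e + v)`. -/
def directionalNorm {n : ℕ} (e : Space n) (p q : ℝ≥0∞) (g : ℝ → Space n → ℂ) : ℝ≥0∞ :=
  eLpNorm (fun r : ℝ =>
    eLpNorm (fun z : ℝ × hyperplane e => g z.1 (r • e + (z.2 : Space n))) q volume) p volume

end NonEllipticSchrodinger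

end

/-! Write a point as `r e + v` with `v` in the hyperplane, and take the Fourier transform in `v`,
with frequency `ζ`. On the line `η e + ζ` the symbol of `-Δ_±` is a real quadratic `q(η) = 4π²(aη² +
2bη + c)`, where `a = e · e_±`, `b = ζ · e_±` and `c = ∑ εᵢ ζᵢ²`. The multiplier of `D_{e_±}` is
`2π(aη + b) = q'(η) / 4π`. By Plancherel in `v`, everything reduces to a one-dimensional bound of
`q'(D)u` in `L^∞_r L²_t` by the source in `L¹_r L²_t`, uniform in `a`, `b`, `c`
(`lintegral_sq_velocityField_le`).

For `t > 0`, take the Laplace transform in time at `z = δ + 2πiτ`. Duhamel's formula becomes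
division by `z + iq(η)`, so the operator has multiplier a constant times `q' / (q - iz)`. This is
the logarithmic derivative of a quadratic without real zeros, hence a sum of at most two simple
fractions `1/(η - z_j)` with residue one. Each of them is convolution with a one-sided exponential
of modulus at most `2π`, so it maps `L¹` to `L^∞` with a bound that sees neither the position of the
pole nor the coefficients (`norm_fourierInv_resolvent_mul_fourier_le`). The signs of the `εᵢ` play
no role here, and when `a = 0` there are merely fewer poles.

Plancherel in `t` on both sides and Minkowski's inequality give the estimate with damping
`exp(-δt)`, and Fatou's lemma removes the damping. Negative times follow by reversing time.
Integrating over `ζ`, with Minkowski once more, yields the theorem for the Duhamel solution.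

An arbitrary solution is the Duhamel solution: for the difference `w` of two solutions, the pairing
of its Fourier transform with a test function transported by `exp(i(s - T)q)` is constant in `s`,
and it vanishes at `s = 0`. -/

noncomputable section

namespace NonEllipticSchrodinger

open scoped FourierTransform

/-! ### Polynomial decay weights. -/

section DecayWeight

variable {E : Type*} [NormedAddCommGroup E]

/-- The weight `(1 + ‖x‖)⁻ᴺ`. -/
def decayWeight (N : ℕ) (x : E) : ℝ := ((1 + ‖x‖) ^ N)⁻¹

lemma decayWeight_pos (N : ℕ) (x : E) : 0 < decayWeight N x := by
  unfold decayWeight; positivity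

lemma decayWeight_nonneg (N : ℕ) (x : E) : 0 ≤ decayWeight N x := (decayWeight_pos N x).le

@[simp]
lemma decayWeight_zero_left (x : E) : decayWeight 0 x = 1 := by simp [decayWeight]

lemma decayWeight_le_one (N : ℕ) (x : E) : decayWeight N x ≤ 1 :=
  inv_le_one_of_one_le₀ (one_le_pow₀ (by linarith [norm_nonneg x]))

lemma decayWeight_add (M N : ℕ) (x : E) :
    decayWeight (M + N) x = decayWeight M x * decayWeight N x := by
  simp only [decayWeight, pow_add, mul_inv]

lemma pow_mul_decayWeight_le (M N : ℕ) (x : E) :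
    (1 + ‖x‖) ^ M * decayWeight (M + N) x ≤ decayWeight N x := by
  have h : 0 < (1 + ‖x‖) ^ M := by positivity
  rw [decayWeight_add, decayWeight, ← mul_assoc, mul_inv_cancel₀ h.ne', one_mul]

lemma decayWeight_le_of_norm_le {F : Type*} [NormedAddCommGroup F] (N : ℕ) {x : E} {y : F}
    (h : ‖x‖ ≤ ‖y‖) : decayWeight N y ≤ decayWeight N x := by
  unfold decayWeight
  gcongr

lemma continuous_decayWeight (N : ℕ) : Continuous (decayWeight N : E → ℝ) := by
  unfold decayWeight
  refine Continuous.inv₀ (by fun_prop) fun x => ?_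
  positivity

lemma integrable_decayWeight [NormedSpace ℝ E] [FiniteDimensional ℝ E] [MeasurableSpace E]
    [BorelSpace E] {μ : Measure E} [μ.IsAddHaarMeasure] {N : ℕ} (hN : Module.finrank ℝ E < N) :
    Integrable (decayWeight N : E → ℝ) μ := by
  have := integrable_one_add_norm (E := E) (μ := μ) (r := (N : ℝ)) (by exact_mod_cast hN)
  refine this.congr (.of_forall fun x => ?_)
  simp only [decayWeight]
  rw [Real.rpow_neg (by positivity), Real.rpow_natCast]

variable [NormedSpace ℝ E] [FiniteDimensional ℝ E] [MeasurableSpace E] [BorelSpace E]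
  {μ : Measure E} [μ.IsAddHaarMeasure]

lemma integrable_of_le_decayWeight {f : E → ℂ} (hf : AEStronglyMeasurable f μ) {N : ℕ} {C : ℝ}
    (hN : Module.finrank ℝ E < N) (h : ∀ x, ‖f x‖ ≤ C * decayWeight N x) : Integrable f μ :=
  ((integrable_decayWeight hN).const_mul C).mono' hf (.of_forall h)

lemma memLp_of_le_decayWeight {f : E → ℂ} (hf : AEStronglyMeasurable f μ) {N : ℕ} {C : ℝ}
    (hN : Module.finrank ℝ E < N) (h : ∀ x, ‖f x‖ ≤ C * decayWeight N x) : MemLp f 2 μ := by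
  rw [memLp_two_iff_integrable_sq_norm hf]
  refine ((integrable_decayWeight hN).const_mul (C ^ 2)).mono' (by fun_prop) (.of_forall fun x => ?_)
  rw [Real.norm_of_nonneg (by positivity)]
  calc ‖f x‖ ^ 2 ≤ (C * decayWeight N x) ^ 2 := by gcongr; exact h x
    _ = C ^ 2 * (decayWeight N x * decayWeight N x) := by ring
    _ ≤ C ^ 2 * (decayWeight N x * 1) := by
        gcongr
        · exact decayWeight_nonneg N x
        · exact decayWeight_le_one N x
    _ = C ^ 2 * decayWeight N x := by ring

end DecayWeight

/-! ### Plancherel's theorem for the Fourier integral, and Minkowski's inequality. -/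

section Plancherel

variable {V : Type*} [NormedAddCommGroup V] [InnerProductSpace ℝ V] [FiniteDimensional ℝ V]
  [MeasurableSpace V] [BorelSpace V]

lemma continuous_fourier_of_integrable {f : V → ℂ} (hf : Integrable f) : Continuous (𝓕 f) :=
  VectorFourier.fourierIntegral_continuous Real.continuous_fourierChar
    (by exact continuous_inner) hf

lemma integral_fourier_mul_comm {f g : V → ℂ} (hf : Integrable f) (hg : Integrable g) :
    ∫ ξ, 𝓕 f ξ * g ξ = ∫ x, f x * 𝓕 g x := by
  have := VectorFourier.integral_fourierIntegral_smul_eq_flip (L := innerₗ V)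
    Real.continuous_fourierChar continuous_inner hf hg
  simpa only [flip_innerₗ, smul_eq_mul] using! this

lemma integral_fourierInv_mul_comm {f g : V → ℂ} (hf : Integrable f) (hg : Integrable g) :
    ∫ ξ, 𝓕⁻ f ξ * g ξ = ∫ x, f x * 𝓕⁻ g x := by
  rw [Real.fourierInv_eq_fourier_comp_neg f, integral_fourier_mul_comm hf.comp_neg hg,
    ← integral_neg_eq_self]
  simp only [neg_neg, Real.fourierInv_eq_fourier_neg]

/-- Both sides are locally integrable and have the same pairing with smooth compactly supported
functions, because each of the two transforms can be moved onto the test function. This links the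
isometry on `L²` to the integral formula. -/
lemma ae_eq_fourier_toLp {f : V → ℂ} (hf : Integrable f) (hf2 : MemLp f 2) :
    (𝓕 (hf2.toLp f) : Lp ℂ 2 (volume : Measure V)) =ᵐ[volume] 𝓕 f := by
  have hloc : LocallyIntegrable (𝓕 (hf2.toLp f) : Lp ℂ 2 (volume : Measure V)) volume :=
    (Lp.memLp _).locallyIntegrable (by norm_num)
  have hcont : LocallyIntegrable (𝓕 f) volume :=
    (continuous_fourier_of_integrable hf).locallyIntegrable
  have key : ∀ᵐ x : V, (𝓕 (hf2.toLp f) : Lp ℂ 2 (volume : Measure V)) x - 𝓕 f x = 0 := by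
    refine ae_eq_zero_of_integral_contDiff_smul_eq_zero (hloc.sub hcont) fun g hg hgc => ?_
    have hg₁ : HasCompactSupport (Complex.ofRealCLM ∘ g) := hgc.comp_left rfl
    have hg₂ : ContDiff ℝ (⊤ : ℕ∞) (Complex.ofRealCLM ∘ g) := Complex.ofRealCLM.contDiff.comp hg
    let φ : 𝓢(V, ℂ) := hg₁.toSchwartzMap hg₂
    have hφ : ∀ x, φ x = (g x : ℂ) := fun x => rfl
    have h1 : ∫ x, g x • (𝓕 (hf2.toLp f) : Lp ℂ 2 (volume : Measure V)) x
        = ∫ x, φ x * 𝓕 f x := by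
      calc _ = Lp.toTemperedDistribution (𝓕 (hf2.toLp f)) φ := by
            rw [Lp.toTemperedDistribution_apply]; rfl
        _ = Lp.toTemperedDistribution (hf2.toLp f) (𝓕 φ) := by
            rw [← Lp.fourier_toTemperedDistribution_eq, TemperedDistribution.fourier_apply]
        _ = ∫ x, 𝓕 (φ : V → ℂ) x * f x := by
            rw [Lp.toTemperedDistribution_apply]
            refine integral_congr_ae ?_
            filter_upwards [hf2.coeFn_toLp] with x hx
            rw [hx, SchwartzMap.fourier_coe, smul_eq_mul]
        _ = _ := integral_fourier_mul_comm φ.integrable hf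
    simp only [smul_sub]
    rw [integral_sub, h1]
    · rw [sub_eq_zero]; rfl
    · exact hloc.integrable_smul_left_of_hasCompactSupport hg.continuous hgc
    · exact hcont.integrable_smul_left_of_hasCompactSupport hg.continuous hgc
  filter_upwards [key] with x hx using sub_eq_zero.mp hx

/-- Plancherel's theorem for the Fourier integral on `L¹ ∩ L²`. -/
lemma eLpNorm_fourier_eq {f : V → ℂ} (hf : Integrable f) (hf2 : MemLp f 2) :
    eLpNorm (𝓕 f) 2 volume = eLpNorm f 2 volume := by
  rw [← eLpNorm_congr_ae (ae_eq_fourier_toLp hf hf2), ← eLpNorm_congr_ae hf2.coeFn_toLp]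
  rw [← Lp.enorm_def, ← Lp.enorm_def, ← ofReal_norm, ← ofReal_norm, Lp.norm_fourier_eq]

lemma memLp_comp_neg_right {f : V → ℂ} (hf : MemLp f 2) : MemLp (fun x => f (-x)) 2 :=
  hf.comp_measurePreserving (Measure.measurePreserving_neg volume)

lemma eLpNorm_fourierInv_eq {f : V → ℂ} (hf : Integrable f) (hf2 : MemLp f 2) :
    eLpNorm (𝓕⁻ f) 2 volume = eLpNorm f 2 volume := by
  rw [Real.fourierInv_eq_fourier_comp_neg, eLpNorm_fourier_eq hf.comp_neg (memLp_comp_neg_right hf2)]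
  exact eLpNorm_comp_measurePreserving hf2.1 (Measure.measurePreserving_neg volume)

lemma memLp_fourierInv {f : V → ℂ} (hf : Integrable f) (hf2 : MemLp f 2) : MemLp (𝓕⁻ f) 2 := by
  refine ⟨?_, (eLpNorm_fourierInv_eq hf hf2).trans_lt hf2.2⟩
  rw [Real.fourierInv_eq_fourier_comp_neg]
  exact (continuous_fourier_of_integrable hf.comp_neg).aestronglyMeasurable

lemma eLpNorm_two_sq {α F : Type*} [MeasurableSpace α] [ENorm F] (f : α → F) (μ : Measure α) :
    eLpNorm f 2 μ ^ 2 = ∫⁻ x, ‖f x‖ₑ ^ 2 ∂μ := by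
  have := eLpNorm_nnreal_pow_eq_lintegral (f := f) (μ := μ) (p := 2) (by norm_num)
  simpa using! this

lemma lintegral_sq_fourier_eq {f : V → ℂ} (hf : Integrable f) (hf2 : MemLp f 2) :
    ∫⁻ ξ, ‖𝓕 f ξ‖ₑ ^ 2 = ∫⁻ x, ‖f x‖ₑ ^ 2 := by
  rw [← eLpNorm_two_sq, ← eLpNorm_two_sq, eLpNorm_fourier_eq hf hf2]

lemma lintegral_sq_fourierInv_eq {f : V → ℂ} (hf : Integrable f) (hf2 : MemLp f 2) :
    ∫⁻ ξ, ‖𝓕⁻ f ξ‖ₑ ^ 2 = ∫⁻ x, ‖f x‖ₑ ^ 2 := by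
  rw [← eLpNorm_two_sq, ← eLpNorm_two_sq, eLpNorm_fourierInv_eq hf hf2]

end Plancherel

/-- Minkowski's integral inequality in `L²`. -/
lemma lintegral_sq_lintegral_le {α β : Type*} [MeasurableSpace α] [MeasurableSpace β]
    {μ : Measure α} {ν : Measure β} [SFinite μ] [SFinite ν] {G : α → β → ℝ≥0∞}
    (hG : Measurable (Function.uncurry G)) :
    ∫⁻ y, (∫⁻ r, G r y ∂μ) ^ 2 ∂ν ≤ (∫⁻ r, (∫⁻ y, G r y ^ 2 ∂ν) ^ (1 / 2 : ℝ) ∂μ) ^ 2 := by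
  have hr : ∀ r, Measurable (G r) := fun r => hG.comp measurable_prodMk_left
  have hy : ∀ y, Measurable fun r => G r y := fun y => hG.comp measurable_prodMk_right
  have hI : Measurable fun y => ∫⁻ r, G r y ∂μ := hG.lintegral_prod_left
  have hN : Measurable fun r => (∫⁻ y, G r y ^ 2 ∂ν) ^ (1 / 2 : ℝ) :=
    (Measurable.lintegral_prod_right' (f := fun z : α × β => G z.1 z.2 ^ 2)
      (hG.pow_const 2)).pow_const _
  -- Expand the square as a double integral in `(r, s)`, exchange the order by Tonelli, and apply
  -- Cauchy–Schwarz in `y` for each pair `(r, s)`.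
  calc ∫⁻ y, (∫⁻ r, G r y ∂μ) ^ 2 ∂ν
      = ∫⁻ y, ∫⁻ r, G r y * ∫⁻ s, G s y ∂μ ∂μ ∂ν := by
        refine lintegral_congr fun y => ?_
        rw [lintegral_mul_const _ (hy y), sq]
    _ = ∫⁻ r, ∫⁻ y, G r y * ∫⁻ s, G s y ∂μ ∂ν ∂μ := by
        refine lintegral_lintegral_swap ?_
        exact ((hG.comp measurable_swap).mul (hI.comp measurable_fst)).aemeasurable
    _ = ∫⁻ r, ∫⁻ s, ∫⁻ y, G r y * G s y ∂ν ∂μ ∂μ := by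
        refine lintegral_congr fun r => ?_
        calc ∫⁻ y, G r y * ∫⁻ s, G s y ∂μ ∂ν = ∫⁻ y, ∫⁻ s, G r y * G s y ∂μ ∂ν := by
              refine lintegral_congr fun y => ?_
              rw [lintegral_const_mul _ (hy y)]
          _ = _ := lintegral_lintegral_swap
              (((hr r).comp measurable_fst).mul (hG.comp measurable_swap)).aemeasurable
    _ ≤ ∫⁻ r, ∫⁻ s, (∫⁻ y, G r y ^ 2 ∂ν) ^ (1 / 2 : ℝ) * (∫⁻ y, G s y ^ 2 ∂ν) ^ (1 / 2 : ℝ) ∂μ ∂μ := by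
        refine lintegral_mono fun r => lintegral_mono fun s => ?_
        have := ENNReal.lintegral_mul_le_Lp_mul_Lq ν Real.HolderConjugate.two_two
          (hr r).aemeasurable (hr s).aemeasurable
        simpa using! this
    _ = _ := by
        simp_rw [lintegral_const_mul _ hN]
        rw [lintegral_mul_const _ hN, sq]

/-! ### Resolvent multipliers on the line. -/

section Resolvent

lemma fourierInv_real_eq (f : ℝ → ℂ) (r : ℝ) :
    𝓕⁻ f r = ∫ η : ℝ, Complex.exp (2 * Real.pi * η * r * Complex.I) * f η := by
  rw [Real.fourierInv_eq']
  refine integral_congr_ae (.of_forall fun η => ?_)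
  simp only [smul_eq_mul, RCLike.inner_apply, conj_trivial]
  congr 2
  push_cast
  ring

lemma fourier_real_eq (f : ℝ → ℂ) (τ : ℝ) :
    𝓕 f τ = ∫ t : ℝ, Complex.exp (-2 * Real.pi * t * τ * Complex.I) * f t := by
  rw [Real.fourier_real_eq_integral_exp_smul]
  refine integral_congr_ae (.of_forall fun η => ?_)
  simp only [smul_eq_mul]
  congr 2
  push_cast
  ring

lemma ofReal_sub_ne_zero {z : ℂ} (hz : z.im ≠ 0) (η : ℝ) : (η : ℂ) - z ≠ 0 := by
  intro h
  apply hz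
  have := congrArg Complex.im h
  simpa using this

lemma continuous_resolvent {z : ℂ} (hz : z.im ≠ 0) : Continuous fun η : ℝ => ((η : ℂ) - z)⁻¹ :=
  Continuous.inv₀ (by fun_prop) (ofReal_sub_ne_zero hz)

lemma norm_resolvent_le {z : ℂ} (hz : z.im ≠ 0) (η : ℝ) : ‖((η : ℂ) - z)⁻¹‖ ≤ |z.im|⁻¹ := by
  rw [norm_inv]
  refine inv_anti₀ (abs_pos.mpr hz) ?_
  simpa using Complex.abs_im_le_norm ((η : ℂ) - z)

/-- The sign `σ` of `Im z` decides on which side the kernel lives: it makes the real part of the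
exponent equal to `-2πσ Im z < 0`, so one formula serves both half planes. -/
lemma resolvent_eq_integral {z : ℂ} {σ : ℝ} (hσ : σ ^ 2 = 1) (hz : 0 < σ * z.im) (η : ℝ) :
    ((η : ℂ) - z)⁻¹ = ∫ s in Set.Ioi (0 : ℝ),
      2 * Real.pi * σ * Complex.I * Complex.exp (2 * Real.pi * σ * Complex.I * (z - η) * s) := by
  have hz0 : z.im ≠ 0 := by
    intro h; simp [h] at hz
  have hre : (2 * Real.pi * σ * Complex.I * (z - η)).re < 0 := by
    have : (2 * Real.pi * σ * Complex.I * (z - η)).re = -(2 * Real.pi * (σ * z.im)) := by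
      simp; ring
    rw [this, neg_lt_zero]
    positivity
  rw [integral_const_mul, integral_exp_mul_complex_Ioi hre]
  have h1 : z - (η : ℂ) ≠ 0 := by
    rw [← neg_ne_zero, neg_sub]; exact ofReal_sub_ne_zero hz0 η
  have hσ0 : (σ : ℂ) ≠ 0 := by
    intro h; rw [Complex.ofReal_eq_zero] at h; simp [h] at hσ
  have hpi : (Real.pi : ℂ) ≠ 0 := by exact_mod_cast Real.pi_ne_zero
  rw [← neg_sub z, inv_neg]
  simp only [Complex.ofReal_zero, mul_zero, Complex.exp_zero]
  field_simp

/-- The Fourier multiplier `1 / (η - z)` is bounded from `L¹` to `L^∞`, uniformly in `z`. -/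
lemma norm_fourierInv_resolvent_mul_fourier_le {z : ℂ} (hz : z.im ≠ 0) {g : ℝ → ℂ}
    (hgc : Continuous g) (hg : Integrable g) (hg' : Integrable (𝓕 g)) (r : ℝ) :
    ‖𝓕⁻ (fun η : ℝ => ((η : ℂ) - z)⁻¹ * 𝓕 g η) r‖ ≤ 2 * Real.pi * ∫ x, ‖g x‖ := by
  obtain ⟨σ, hσ, hσz⟩ : ∃ σ : ℝ, σ ^ 2 = 1 ∧ 0 < σ * z.im := by
    rcases lt_or_gt_of_ne hz with h | h
    · exact ⟨-1, by norm_num, by linarith⟩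
    · exact ⟨1, by norm_num, by linarith⟩
  have hσabs : |σ| = 1 := by
    rcases sq_eq_one_iff.mp hσ with h | h <;> simp [h]
  have hinv := hgc.fourierInv_fourier_eq hg hg'
  have hexp : ∀ s : ℝ, ‖Complex.exp (2 * Real.pi * σ * Complex.I * z * s)‖
      = Real.exp (-(2 * Real.pi * (σ * z.im)) * s) := fun s => by
    rw [Complex.norm_exp]
    congr 1
    have : (2 * Real.pi * σ * Complex.I * z * s).re = -(2 * Real.pi * (σ * z.im)) * s := by
      simp only [Complex.mul_re, Complex.mul_im, Complex.ofReal_re, Complex.ofReal_im,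
        Complex.I_re, Complex.I_im, Complex.re_ofNat, Complex.im_ofNat]
      ring
    exact this
  have hdecay : IntegrableOn (fun s : ℝ => Complex.exp (2 * Real.pi * σ * Complex.I * z * s))
      (Set.Ioi 0) := by
    refine integrableOn_exp_mul_complex_Ioi ?_ 0
    have : (2 * Real.pi * σ * Complex.I * z).re = -(2 * Real.pi * (σ * z.im)) := by simp; ring
    rw [this, neg_lt_zero]
    positivity
  -- After Fubini and Fourier inversion the multiplier is a one-sided convolution with an
  -- exponential kernel.
  have hrep : 𝓕⁻ (fun η : ℝ => ((η : ℂ) - z)⁻¹ * 𝓕 g η) r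
      = ∫ s in Set.Ioi (0 : ℝ), 2 * Real.pi * σ * Complex.I *
        Complex.exp (2 * Real.pi * σ * Complex.I * z * s) * g (r - σ * s) := by
    rw [fourierInv_real_eq]
    calc _ = ∫ η : ℝ, ∫ s in Set.Ioi (0 : ℝ), 2 * Real.pi * σ * Complex.I *
            Complex.exp (2 * Real.pi * σ * Complex.I * z * s) *
            (Complex.exp (2 * Real.pi * η * (r - σ * s : ℝ) * Complex.I) * 𝓕 g η) := by
          refine integral_congr_ae (.of_forall fun η => ?_)
          simp only
          rw [resolvent_eq_integral hσ hσz, ← integral_mul_const, ← integral_const_mul]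
          refine integral_congr_ae (.of_forall fun s => ?_)
          simp only
          have : Complex.exp (2 * Real.pi * σ * Complex.I * (z - η) * s)
              * Complex.exp (2 * Real.pi * η * r * Complex.I)
              = Complex.exp (2 * Real.pi * σ * Complex.I * z * s)
              * Complex.exp (2 * Real.pi * η * (r - σ * s : ℝ) * Complex.I) := by
            rw [← Complex.exp_add, ← Complex.exp_add]
            congr 1
            push_cast
            ring
          linear_combination (2 * Real.pi * σ * Complex.I * 𝓕 g η) * this
      _ = ∫ s in Set.Ioi (0 : ℝ), ∫ η : ℝ, 2 * Real.pi * σ * Complex.I *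
            Complex.exp (2 * Real.pi * σ * Complex.I * z * s) *
            (Complex.exp (2 * Real.pi * η * (r - σ * s : ℝ) * Complex.I) * 𝓕 g η) := by
          refine integral_integral_swap ?_
          have hprod := (hg'.mul_prod hdecay).const_mul (2 * Real.pi * σ * Complex.I)
          refine (hprod.bdd_mul (c := 1)
            (f := fun z : ℝ × ℝ => Complex.exp (2 * Real.pi * z.1 * (r - σ * z.2 : ℝ) * Complex.I))
            ?_ ?_).congr ?_
          · exact Continuous.aestronglyMeasurable (by fun_prop)
          · refine .of_forall fun w => ?_
            rw [Complex.norm_exp]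
            simp
          · refine .of_forall fun w => ?_
            simp only [Function.uncurry]
            ring
      _ = _ := by
          refine integral_congr_ae (.of_forall fun s => ?_)
          simp only
          rw [integral_const_mul]
          congr 1
          rw [← fourierInv_real_eq, hinv]
  have hshift : Integrable fun s : ℝ => g (r - σ * s) := by
    have := (hg.comp_sub_left r).comp_mul_left' (R := σ) (by rintro rfl; simp at hσ)
    exact this
  rw [hrep]
  calc _ ≤ ∫ s in Set.Ioi (0 : ℝ), 2 * Real.pi * ‖g (r - σ * s)‖ := by
        refine norm_integral_le_of_norm_le (hshift.norm.const_mul _).integrableOn ?_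
        refine (ae_restrict_iff' measurableSet_Ioi).mpr (.of_forall fun s hs => ?_)
        rw [norm_mul, norm_mul, hexp]
        have h1 : ‖(2 * Real.pi * σ * Complex.I : ℂ)‖ = 2 * Real.pi := by
          simp [hσabs, abs_of_pos Real.pi_pos]
        have h2 : Real.exp (-(2 * Real.pi * (σ * z.im)) * s) ≤ 1 := by
          rw [Real.exp_le_one_iff]
          have hs' : 0 < s := hs
          have : 0 < 2 * Real.pi * (σ * z.im) * s := by positivity
          linarith
        rw [h1]
        have := Real.pi_pos
        calc _ ≤ 2 * Real.pi * 1 * ‖g (r - σ * s)‖ := by gcongr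
          _ = _ := by ring
    _ ≤ ∫ s, 2 * Real.pi * ‖g (r - σ * s)‖ := by
        refine setIntegral_le_integral (hshift.norm.const_mul _) (.of_forall fun s => ?_)
        have := Real.pi_pos
        show 0 ≤ 2 * Real.pi * ‖g (r - σ * s)‖
        positivity
    _ = 2 * Real.pi * ∫ x, ‖g x‖ := by
        rw [integral_const_mul, Measure.integral_comp_mul_left (fun x => ‖g (r - x)‖),
          integral_sub_left_eq_self (fun x => ‖g x‖)]
        simp [hσabs]

/-- The logarithmic derivative of a nonconstant real quadratic with nonreal constant term is a
sum of at most two resolvents. -/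
lemma norm_fourierInv_logDeriv_mul_fourier_le (a b : ℝ) {c : ℂ} (hc : c.im ≠ 0) {g : ℝ → ℂ}
    (hgc : Continuous g) (hg : Integrable g) (hg' : Integrable (𝓕 g)) (r : ℝ) :
    ‖𝓕⁻ (fun η : ℝ => (2 * (a * η + b) / (a * η ^ 2 + 2 * b * η + c) : ℂ) * 𝓕 g η : ℝ → ℂ) r‖
      ≤ 4 * Real.pi * ∫ x, ‖g x‖ := by
  have hpi := Real.pi_pos
  have hI : 0 ≤ ∫ x, ‖g x‖ := integral_nonneg fun _ => norm_nonneg _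
  by_cases ha : a = 0
  · subst ha
    by_cases hb : b = 0
    · subst hb
      simp only [fourierInv_real_eq]
      simp
      positivity
    · have hz : (-c / (2 * b) : ℂ).im ≠ 0 := by
        have : (-c / (2 * b) : ℂ) = (-(2 * b)⁻¹ : ℝ) * c := by push_cast; field_simp
        rw [this, Complex.im_ofReal_mul]
        exact mul_ne_zero (by simpa using hb) hc
      have h1 := norm_fourierInv_resolvent_mul_fourier_le hz hgc hg hg' r
      have hbC : (b : ℂ) ≠ 0 := by exact_mod_cast hb
      have : (fun η : ℝ => (2 * ((0 : ℝ) * η + b) / ((0 : ℝ) * η ^ 2 + 2 * b * η + c) : ℂ) * 𝓕 g η)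
          = fun η : ℝ => ((η : ℂ) - -c / (2 * b))⁻¹ * 𝓕 g η := by
        funext η
        congr 1
        have h2 : (η : ℂ) - -c / (2 * b) = (2 * b * η + c) / (2 * b) := by field_simp; ring
        rw [h2, inv_div]
        simp
      rw [this]
      nlinarith
  -- `d` is a square root of the discriminant, possibly zero, and `z₁`, `z₂` are the roots counted
  -- with multiplicity.
  · obtain ⟨d, hd⟩ := IsAlgClosed.exists_pow_nat_eq ((b : ℂ) ^ 2 - a * c) (n := 2) (by norm_num)
    have haC : (a : ℂ) ≠ 0 := by exact_mod_cast ha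
    set z₁ : ℂ := (-b + d) / a
    set z₂ : ℂ := (-b - d) / a
    have hfac : ∀ w : ℂ, a * w ^ 2 + 2 * b * w + c = a * ((w - z₁) * (w - z₂)) := fun w => by
      simp only [z₁, z₂]
      field_simp
      linear_combination hd
    -- A real root would force `c` to be real, since `a` and `b` are.
    have hroot : ∀ w : ℂ, a * w ^ 2 + 2 * b * w + c = 0 → w.im ≠ 0 := by
      intro w hw him
      apply hc
      have hw' : w = (w.re : ℂ) := Complex.ext rfl (by simp [him])
      have : c = ((-(a * w.re ^ 2 + 2 * b * w.re) : ℝ) : ℂ) := by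
        rw [hw'] at hw
        push_cast
        linear_combination hw
      rw [this, Complex.ofReal_im]
    have h₁ : z₁.im ≠ 0 := hroot _ (by rw [hfac]; ring)
    have h₂ : z₂.im ≠ 0 := hroot _ (by rw [hfac]; ring)
    have hint : ∀ z : ℂ, z.im ≠ 0 → Integrable fun η : ℝ =>
        Complex.exp (2 * Real.pi * η * r * Complex.I) * (((η : ℂ) - z)⁻¹ * 𝓕 g η) := by
      intro z hz
      refine Integrable.bdd_mul (c := 1) ?_
        (Continuous.aestronglyMeasurable (by fun_prop)) (.of_forall fun w => ?_)
      · exact hg'.bdd_mul (c := |z.im|⁻¹) (continuous_resolvent hz).aestronglyMeasurable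
          (.of_forall (norm_resolvent_le hz))
      · rw [Complex.norm_exp]
        simp
    have hsum : 𝓕⁻ (fun η : ℝ => (2 * (a * η + b) / (a * η ^ 2 + 2 * b * η + c) : ℂ) * 𝓕 g η : ℝ → ℂ) r
        = 𝓕⁻ (fun η : ℝ => ((η : ℂ) - z₁)⁻¹ * 𝓕 g η) r
          + 𝓕⁻ (fun η : ℝ => ((η : ℂ) - z₂)⁻¹ * 𝓕 g η) r := by
      simp only [fourierInv_real_eq]
      rw [← integral_add (hint _ h₁) (hint _ h₂)]
      refine integral_congr_ae (.of_forall fun η => ?_)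
      simp only
      rw [hfac]
      have e₁ := ofReal_sub_ne_zero h₁ η
      have e₂ := ofReal_sub_ne_zero h₂ η
      -- The numerator is the derivative of the factored denominator, because `z₁ + z₂ = -2b/a`.
      -- Hence both residues are one, even for a double root.
      have e₃ : (2 * (a * η + b) : ℂ) = a * ((η - z₁) + (η - z₂)) := by
        simp only [z₁, z₂]
        field_simp
        ring
      rw [e₃]
      field_simp
      ring
    rw [hsum]
    have b₁ := norm_fourierInv_resolvent_mul_fourier_le h₁ hgc hg hg' r
    have b₂ := norm_fourierInv_resolvent_mul_fourier_le h₂ hgc hg hg' r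
    exact (norm_add_le _ _).trans (by linarith)

end Resolvent

/-- The Laplace transform of the Duhamel integral. -/
lemma integral_exp_mul_duhamel {z : ℂ} (hz : 0 < z.re) (q : ℝ) {f : ℝ → ℂ} (hf : Integrable f) :
    ∫ t in Set.Ioi (0 : ℝ), Complex.exp (-z * t) *
        ∫ s in (0 : ℝ)..t, Complex.exp (-Complex.I * ((t - s) * q)) * f s
      = (z + Complex.I * q)⁻¹ * ∫ s in Set.Ioi (0 : ℝ), Complex.exp (-z * s) * f s := by
  have hre : (-(z + Complex.I * q)).re < 0 := by simpa using hz
  have h1 : IntegrableOn (fun s : ℝ => Complex.exp (-z * s) * f s) (Set.Ioi 0) := by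
    refine Integrable.bdd_mul (c := 1) hf.integrableOn
      (Continuous.aestronglyMeasurable (by fun_prop)) ?_
    refine (ae_restrict_iff' measurableSet_Ioi).mpr (.of_forall fun s hs => ?_)
    have hs' : 0 < s := hs
    rw [Complex.norm_exp, Real.exp_le_one_iff]
    simp
    positivity
  -- The Duhamel integral is a convolution on the half-line, and `exp(-zt) = exp(-zs) exp(-z(t -
  -- s))` distributes over it, so the Laplace integral factors.
  have key := integral_posConvolution (μ := volume) (ν := volume) h1
    (integrableOn_exp_mul_complex_Ioi hre 0) (ContinuousLinearMap.mul ℝ ℂ)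
  simp only [ContinuousLinearMap.mul_apply'] at key
  rw [integral_exp_mul_complex_Ioi hre] at key
  have h0 : -Complex.exp (-(z + Complex.I * q) * (0 : ℝ)) / -(z + Complex.I * q)
      = (z + Complex.I * q)⁻¹ := by
    rw [neg_div_neg_eq]
    simp
  rw [h0] at key
  rw [mul_comm, ← key]
  refine integral_congr_ae (.of_forall fun t => ?_)
  beta_reduce
  rw [← intervalIntegral.integral_const_mul]
  refine intervalIntegral.integral_congr fun s _ => ?_
  have : Complex.exp (-z * t) * Complex.exp (-Complex.I * ((t - s) * q))
      = Complex.exp (-z * s) * Complex.exp (-(z + Complex.I * q) * (t - s : ℝ)) := by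
    rw [← Complex.exp_add, ← Complex.exp_add]
    congr 1
    push_cast
    ring
  linear_combination (f s) * this

/-! ### Derivatives in the space variable of Schwartz functions of `(t, x)`. -/

section PartialDerivative

variable {E : Type*} [NormedAddCommGroup E] [NormedSpace ℝ E]

/-- The restriction to a fixed time is a translate of `G` composed with the inclusion `y ↦ (0, y)`,
which has norm at most one. -/
lemma norm_iteratedFDeriv_comp_prodMk_le {G : ℝ × E → ℂ} (hG : ContDiff ℝ (⊤ : ℕ∞) G)
    (s : ℝ) (k : ℕ) (x : E) :
    ‖iteratedFDeriv ℝ k (fun y => G (s, y)) x‖ ≤ ‖iteratedFDeriv ℝ k G (s, x)‖ := by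
  have h1 : (fun y => G (s, y))
      = (fun z : ℝ × E => G ((s, 0) + z)) ∘ (ContinuousLinearMap.inr ℝ ℝ E) := by
    funext y
    simp
  have h2 : ContDiff ℝ (⊤ : ℕ∞) (fun z : ℝ × E => G ((s, 0) + z)) :=
    hG.comp (contDiff_const.add contDiff_id)
  rw [h1, ContinuousLinearMap.iteratedFDeriv_comp_right _ h2 x (by exact_mod_cast le_top)]
  refine (ContinuousMultilinearMap.norm_compContinuousLinearMap_le _ _).trans ?_
  have h3 : iteratedFDeriv ℝ k (fun z : ℝ × E => G ((s, 0) + z)) (ContinuousLinearMap.inr ℝ ℝ E x)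
      = iteratedFDeriv ℝ k G (s, x) := by
    rw [iteratedFDeriv_comp_add_left]
    simp
  rw [h3]
  have h4 : ‖ContinuousLinearMap.inr ℝ ℝ E‖ ≤ 1 :=
    ContinuousLinearMap.opNorm_le_bound _ zero_le_one fun y => by simp [Prod.norm_def]
  calc _ ≤ ‖iteratedFDeriv ℝ k G (s, x)‖ * 1 := by
        gcongr
        exact Finset.prod_le_one (fun _ _ => norm_nonneg _) fun _ _ => h4
    _ = _ := mul_one _

/-- The joint norm dominates both `‖s‖` and `‖x‖`, so decay of order `2 + N` splits into a product.
Order `2` in time is enough for integrability on `ℝ`. -/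
lemma exists_iteratedFDeriv_bound (F : 𝓢(ℝ × E, ℂ)) (k N : ℕ) :
    ∃ C : ℝ, 0 ≤ C ∧ ∀ s x, ‖iteratedFDeriv ℝ k (fun y => F (s, y)) x‖
      ≤ C * (decayWeight 2 s * decayWeight N x) := by
  refine ⟨2 ^ (2 + N) * ((Finset.Iic ((2 + N, k) : ℕ × ℕ)).sup
    fun m => SchwartzMap.seminorm ℝ m.1 m.2) F, by positivity, fun s x => ?_⟩
  refine (norm_iteratedFDeriv_comp_prodMk_le (F.smooth ⊤) s k x).trans ?_
  have h := SchwartzMap.one_add_le_sup_seminorm_apply (𝕜 := ℝ) (m := (2 + N, k)) le_rfl le_rfl F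
    (s, x)
  have h1 : ‖s‖ ≤ ‖(s, x)‖ := le_max_left _ _
  have h2 : ‖x‖ ≤ ‖(s, x)‖ := le_max_right _ _
  have h3 : (1 + ‖s‖) ^ 2 * (1 + ‖x‖) ^ N ≤ (1 + ‖(s, x)‖) ^ (2 + N) := by
    rw [pow_add]
    gcongr
  rw [decayWeight, decayWeight, ← mul_inv, ← div_eq_mul_inv, le_div_iff₀ (by positivity), mul_comm]
  refine le_trans ?_ h
  gcongr

lemma one_add_pow_le (N : ℕ) {x : ℝ} (hx : 0 ≤ x) : (1 + x) ^ N ≤ 2 ^ N * (1 + x ^ N) := by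
  rcases le_total x 1 with h | h
  · calc (1 + x) ^ N ≤ 2 ^ N := by gcongr; linarith
      _ ≤ 2 ^ N * (1 + x ^ N) := le_mul_of_one_le_right (by positivity) (by linarith [pow_nonneg hx N])
  · calc (1 + x) ^ N ≤ (2 * x) ^ N := by gcongr; linarith
      _ = 2 ^ N * x ^ N := mul_pow _ _ _
      _ ≤ _ := by gcongr; linarith

end PartialDerivative

/-! ### Decaying sources and Duhamel's formula on the frequency side. -/

section Decaying

variable {E : Type*} [NormedAddCommGroup E] [InnerProductSpace ℝ E] [FiniteDimensional ℝ E]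
  [MeasurableSpace E] [BorelSpace E]

/-- A continuous function of `(t, x)` which, together with its Fourier transform in `x`, decays
quadratically in `t` and rapidly in the space or frequency variable. -/
structure IsDecaying (F : ℝ → E → ℂ) : Prop where
  continuous : Continuous (Function.uncurry F)
  bound : ∀ N : ℕ, ∃ C : ℝ, 0 ≤ C ∧ ∀ s x, ‖F s x‖ ≤ C * (decayWeight 2 s * decayWeight N x)
  fourier_bound : ∀ N : ℕ, ∃ C : ℝ, 0 ≤ C ∧
    ∀ s ξ, ‖𝓕 (F s) ξ‖ ≤ C * (decayWeight 2 s * decayWeight N ξ)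

/-- The Fourier bound holds because `‖ξ‖ ^ n` times the transform is controlled by the `L¹` norms of
the derivatives in `x` up to order `n`, and these norms inherit the quadratic decay in time. -/
lemma isDecaying_of_schwartz (F : 𝓢(ℝ × E, ℂ)) : IsDecaying fun t (x : E) => F (t, x) where
  continuous := F.continuous
  bound N := by
    obtain ⟨C, hC, h⟩ := exists_iteratedFDeriv_bound F 0 N
    exact ⟨C, hC, fun s x => by simpa using h s x⟩
  fourier_bound N := by
    set M := Module.finrank ℝ E + 1
    choose C hC hb using fun k => exists_iteratedFDeriv_bound F k M
    set W : ℝ := ∫ x : E, decayWeight M x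
    have hM : Module.finrank ℝ E < M := Nat.lt_succ_self _
    have hW : 0 ≤ W := integral_nonneg fun x => decayWeight_nonneg M x
    have hsm : ∀ s, ContDiff ℝ (⊤ : ℕ∞) fun y => F (s, y) := fun s =>
      (F.smooth ⊤).comp (contDiff_const.prodMk contDiff_id)
    have hcont : ∀ s k, Continuous fun x => ‖iteratedFDeriv ℝ k (fun y => F (s, y)) x‖ :=
      fun s k => ((hsm s).continuous_iteratedFDeriv (by exact_mod_cast le_top)).norm
    have hint : ∀ s k, Integrable fun x => ‖iteratedFDeriv ℝ k (fun y => F (s, y)) x‖ := by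
      intro s k
      refine ((integrable_decayWeight hM).const_mul (C k * decayWeight 2 s)).mono'
        (hcont s k).aestronglyMeasurable (.of_forall fun x => ?_)
      rw [norm_norm, mul_assoc]
      exact hb k s x
    have hle : ∀ s k, ∫ x, ‖iteratedFDeriv ℝ k (fun y => F (s, y)) x‖
        ≤ C k * W * decayWeight 2 s := by
      intro s k
      calc _ ≤ ∫ x, C k * decayWeight 2 s * decayWeight M x := by
            refine integral_mono (hint s k) ((integrable_decayWeight hM).const_mul _) fun x => ?_
            rw [mul_assoc]
            exact hb k s x
        _ = _ := by rw [integral_const_mul]; ring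
    have hfour : ∀ n s ξ, ‖ξ‖ ^ n * ‖𝓕 (fun y => F (s, y)) ξ‖
        ≤ 2 ^ n * (∑ j ∈ Finset.range (n + 1), C j * W) * decayWeight 2 s := by
      intro n s ξ
      have := Real.pow_mul_norm_iteratedFDeriv_fourier_le (K := 0) (N := ⊤) (k := 0) (n := n)
        (hsm s) (fun k m hk _ => by
          obtain rfl : k = 0 := by simpa using hk
          simpa using hint s m) le_rfl le_top ξ
      simp only [norm_iteratedFDeriv_zero, pow_zero, one_mul, Nat.cast_zero, mul_zero, zero_add,
        Finset.range_one, Finset.singleton_product, Finset.sum_map, Function.Embedding.coeFn_mk]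
        at this
      refine this.trans ?_
      rw [mul_assoc, Finset.sum_mul]
      gcongr with j hj
      exact hle s j
    set K : ℕ → ℝ := fun n => 2 ^ n * ∑ j ∈ Finset.range (n + 1), C j * W
    have hK : ∀ n, 0 ≤ K n := fun n =>
      mul_nonneg (by positivity) (Finset.sum_nonneg fun j _ => mul_nonneg (hC j) hW)
    -- The bounds with powers `0` and `N` of `‖ξ‖` combine through `(1 + ‖ξ‖) ^ N ≤ 2 ^ N (1 + ‖ξ‖ ^
    -- N)`.
    refine ⟨2 ^ N * (K 0 + K N), by have := hK 0; have := hK N; positivity, fun s ξ => ?_⟩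
    have h0 := hfour 0 s ξ
    have hN := hfour N s ξ
    rw [pow_zero, one_mul] at h0
    have hp := one_add_pow_le N (norm_nonneg ξ)
    rw [show decayWeight N ξ = ((1 + ‖ξ‖) ^ N)⁻¹ from rfl, ← mul_assoc, ← div_eq_mul_inv,
      le_div_iff₀ (by positivity)]
    calc _ ≤ ‖𝓕 (fun y => F (s, y)) ξ‖ * (2 ^ N * (1 + ‖ξ‖ ^ N)) := by gcongr
      _ = 2 ^ N * (‖𝓕 (fun y => F (s, y)) ξ‖ + ‖ξ‖ ^ N * ‖𝓕 (fun y => F (s, y)) ξ‖) := by ring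
      _ ≤ 2 ^ N * (K 0 * decayWeight 2 s + K N * decayWeight 2 s) := by
          gcongr
      _ = _ := by ring

namespace IsDecaying

variable {F : ℝ → E → ℂ}

lemma continuous_apply (hF : IsDecaying F) (s : ℝ) : Continuous (F s) :=
  hF.continuous.comp (Continuous.prodMk_right s)

lemma integrable_apply (hF : IsDecaying F) (s : ℝ) : Integrable (F s) := by
  obtain ⟨C, -, h⟩ := hF.bound (Module.finrank ℝ E + 1)
  refine integrable_of_le_decayWeight (hF.continuous_apply s).aestronglyMeasurable
    (Nat.lt_succ_self _) (C := C * decayWeight 2 s) fun x => ?_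
  rw [mul_assoc]
  exact h s x

lemma continuous_fourier (hF : IsDecaying F) :
    Continuous (Function.uncurry fun s ξ => 𝓕 (F s) ξ) := by
  obtain ⟨C, hC, h⟩ := hF.bound (Module.finrank ℝ E + 1)
  simp only [Function.uncurry_def, Real.fourier_eq']
  refine continuous_of_dominated (bound := fun x => C * decayWeight (Module.finrank ℝ E + 1) x)
    (fun z => ?_) (fun z => .of_forall fun x => ?_) ?_ (.of_forall fun x => ?_)
  · have := hF.continuous_apply z.1
    exact Continuous.aestronglyMeasurable (by fun_prop)
  · rw [norm_smul, Complex.norm_exp_ofReal_mul_I, one_mul]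
    refine (h _ _).trans ?_
    gcongr
    exact mul_le_of_le_one_left (decayWeight_nonneg _ _) (decayWeight_le_one _ _)
  · exact (integrable_decayWeight (Nat.lt_succ_self _)).const_mul C
  · have : Continuous fun z : ℝ × E => F z.1 x :=
      hF.continuous.comp (by fun_prop : Continuous fun z : ℝ × E => (z.1, x))
    exact (Complex.continuous_exp.comp (by fun_prop)).smul this

lemma continuous_fourier_right (hF : IsDecaying F) (s : ℝ) : Continuous (𝓕 (F s)) :=
  continuous_fourier_of_integrable (hF.integrable_apply s)

lemma integrable_fourier_left (hF : IsDecaying F) (ξ : E) : Integrable fun s => 𝓕 (F s) ξ := by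
  obtain ⟨C, -, h⟩ := hF.fourier_bound 0
  refine integrable_of_le_decayWeight ?_ (N := 2) (by simp) (C := C * decayWeight 0 ξ) fun s => ?_
  · exact (hF.continuous_fourier.comp (by fun_prop : Continuous fun s : ℝ => (s, ξ))).aestronglyMeasurable
  · refine (h s ξ).trans_eq (by ring)

lemma comp_neg (hF : IsDecaying F) : IsDecaying fun s x => -F (-s) x where
  continuous := (hF.continuous.comp (by fun_prop : Continuous fun z : ℝ × E => (-z.1, z.2))).neg
  bound N := by
    obtain ⟨C, hC, h⟩ := hF.bound N
    exact ⟨C, hC, fun s x => by simpa [decayWeight] using h (-s) x⟩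
  fourier_bound N := by
    obtain ⟨C, hC, h⟩ := hF.fourier_bound N
    refine ⟨C, hC, fun s ξ => ?_⟩
    have h1 : 𝓕 (fun x => -F (-s) x) ξ = -𝓕 (F (-s)) ξ := by
      simp only [Real.fourier_eq', smul_neg, integral_neg]
    rw [h1, norm_neg]
    simpa [decayWeight] using h (-s) ξ

end IsDecaying

/-- The Fourier transform in `x` of the solution of `(i∂ₜ - q(D)) u = F`, `u(0) = 0`. -/
def duhamel (q : E → ℝ) (F : ℝ → E → ℂ) (t : ℝ) (ξ : E) : ℂ :=
  -Complex.I * ∫ s in (0 : ℝ)..t, Complex.exp (-Complex.I * ((t - s) * q ξ)) * 𝓕 (F s) ξ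

variable {q : E → ℝ} {F : ℝ → E → ℂ}

lemma duhamel_zero_left (q : E → ℝ) (F : ℝ → E → ℂ) (ξ : E) : duhamel q F 0 ξ = 0 := by
  simp [duhamel]

lemma norm_exp_neg_I_mul (x : ℝ) : ‖Complex.exp (-Complex.I * x)‖ = 1 := by
  rw [Complex.norm_exp]
  simp

lemma continuous_duhamel (hF : IsDecaying F) (hq : Continuous q) :
    Continuous (Function.uncurry (duhamel q F)) := by
  unfold duhamel
  simp only [Function.uncurry_def]
  refine continuous_const.mul ?_
  refine intervalIntegral.continuous_parametric_intervalIntegral_of_continuous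
    (f := fun (z : ℝ × E) s => Complex.exp (-Complex.I * ((z.1 - s) * q z.2)) * 𝓕 (F s) z.2) ?_
    continuous_fst
  have := hF.continuous_fourier.comp
    (by fun_prop : Continuous fun w : (ℝ × E) × ℝ => (w.2, w.1.2))
  simp only [Function.uncurry_def, Function.comp_def] at this ⊢
  fun_prop

lemma continuous_duhamel_right (hF : IsDecaying F) (hq : Continuous q) (t : ℝ) :
    Continuous (duhamel q F t) :=
  (continuous_duhamel hF hq).uncurry_left t

/-- The propagator has modulus one and the source is integrable in time, so rapid decay in frequency
persists uniformly in `t`. -/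
lemma exists_norm_duhamel_le (q : E → ℝ) (hF : IsDecaying F) (N : ℕ) :
    ∃ C : ℝ, 0 ≤ C ∧ ∀ t ξ, ‖duhamel q F t ξ‖ ≤ C * decayWeight N ξ := by
  obtain ⟨C, hC, h⟩ := hF.fourier_bound N
  have hw : Integrable (decayWeight 2 : ℝ → ℝ) := integrable_decayWeight (by simp)
  refine ⟨C * ∫ s : ℝ, decayWeight 2 s,
    mul_nonneg hC (integral_nonneg fun s => decayWeight_nonneg 2 s), fun t ξ => ?_⟩
  rw [duhamel, norm_mul, norm_neg, Complex.norm_I, one_mul]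
  refine (intervalIntegral.norm_integral_le_integral_norm_uIoc).trans ?_
  have hnorm : ∀ s : ℝ, ‖Complex.exp (-Complex.I * ((t - s) * q ξ)) * 𝓕 (F s) ξ‖
      ≤ C * decayWeight N ξ * decayWeight 2 s := fun s => by
    have := norm_exp_neg_I_mul ((t - s) * q ξ)
    push_cast at this
    rw [norm_mul, this, one_mul]
    exact (h s ξ).trans_eq (by ring)
  have hmaj := hw.const_mul (C * decayWeight N ξ)
  calc _ ≤ ∫ s in Set.uIoc 0 t, C * decayWeight N ξ * decayWeight 2 s := by
        refine integral_mono_of_nonneg (.of_forall fun _ => norm_nonneg _) hmaj.integrableOn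
          (.of_forall hnorm)
    _ ≤ ∫ s, C * decayWeight N ξ * decayWeight 2 s := by
        refine setIntegral_le_integral hmaj (.of_forall fun s => ?_)
        exact mul_nonneg (mul_nonneg hC (decayWeight_nonneg _ _)) (decayWeight_nonneg _ _)
    _ = _ := by rw [integral_const_mul]; ring

lemma hasDerivAt_duhamel (hF : IsDecaying F) (ξ : E) (t : ℝ) :
    HasDerivAt (fun t => duhamel q F t ξ)
      (-Complex.I * (q ξ * duhamel q F t ξ) - Complex.I * 𝓕 (F t) ξ) t := by
  -- Factoring the propagator takes `t` out of the integrand, so that the product rule and the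
  -- fundamental theorem of calculus suffice.
  have hsplit : ∀ t : ℝ, duhamel q F t ξ = -Complex.I * (Complex.exp (-Complex.I * (t * q ξ)) *
      ∫ s in (0 : ℝ)..t, Complex.exp (Complex.I * (s * q ξ)) * 𝓕 (F s) ξ) := by
    intro t
    rw [duhamel, ← intervalIntegral.integral_const_mul (Complex.exp (-Complex.I * (t * q ξ)))]
    refine congrArg (-Complex.I * ·) (intervalIntegral.integral_congr fun s _ => ?_)
    rw [← mul_assoc (Complex.exp _), ← Complex.exp_add]
    congr 2
    ring
  have hcont : Continuous fun s : ℝ => Complex.exp (Complex.I * (s * q ξ)) * 𝓕 (F s) ξ := by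
    have : Continuous fun s => 𝓕 (F s) ξ :=
      hF.continuous_fourier.comp (by fun_prop : Continuous fun s : ℝ => (s, ξ))
    exact (by fun_prop : Continuous fun s : ℝ => Complex.exp (Complex.I * (s * q ξ))).mul this
  have h1 : HasDerivAt
      (fun t : ℝ => ∫ s in (0 : ℝ)..t, Complex.exp (Complex.I * (s * q ξ)) * 𝓕 (F s) ξ)
      (Complex.exp (Complex.I * (t * q ξ)) * 𝓕 (F t) ξ) t :=
    (hcont.integral_hasStrictDerivAt 0 t).hasDerivAt
  have h2 : HasDerivAt (fun t : ℝ => Complex.exp (-Complex.I * (t * q ξ)))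
      (Complex.exp (-Complex.I * (t * q ξ)) * (-Complex.I * (1 * q ξ))) t := by
    refine HasDerivAt.cexp ?_
    exact ((Complex.ofRealCLM.hasDerivAt (x := t)).mul_const _).const_mul _
  have h3 := (h2.mul h1).const_mul (-Complex.I)
  rw [hsplit t]
  refine (h3.congr_of_eventuallyEq (.of_forall fun t => ?_)).congr_deriv ?_
  · exact hsplit t
  · have : Complex.exp (-Complex.I * (t * q ξ)) * Complex.exp (Complex.I * (t * q ξ)) = 1 := by
      rw [← Complex.exp_add]
      simp
    linear_combination (-Complex.I * 𝓕 (F t) ξ) * this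

/-- If `u` solves the equation with symbol `q` and source `F`, then `u(-t)` solves it with symbol
`-q` and source `-F(-t)`. This transfers estimates from positive to negative times. -/
lemma duhamel_neg_left (q : E → ℝ) (F : ℝ → E → ℂ) (t : ℝ) (ξ : E) :
    duhamel q F (-t) ξ = duhamel (fun ξ => -q ξ) (fun s x => -F (-s) x) t ξ := by
  have h1 : ∀ s, 𝓕 (fun x => -F (-s) x) ξ = -𝓕 (F (-s)) ξ := fun s => by
    simp only [Real.fourier_eq', smul_neg, integral_neg]
  simp only [duhamel, h1]
  congr 1
  have h2 : ∫ s in (0 : ℝ)..-t, Complex.exp (-Complex.I * ((((-t : ℝ) : ℂ) - s) * q ξ)) * 𝓕 (F s) ξ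
      = -∫ s in (0 : ℝ)..t, Complex.exp (-Complex.I * ((((-t : ℝ) : ℂ) - (-s : ℝ)) * q ξ))
        * 𝓕 (F (-s)) ξ := by
    rw [intervalIntegral.integral_comp_neg (fun s : ℝ =>
      Complex.exp (-Complex.I * ((((-t : ℝ) : ℂ) - s) * q ξ)) * 𝓕 (F s) ξ), neg_zero,
      intervalIntegral.integral_symm]
  rw [h2, ← intervalIntegral.integral_neg]
  refine intervalIntegral.integral_congr fun s _ => ?_
  simp only [mul_neg]
  congr 3
  push_cast
  ring

end Decaying

/-! ### The symbol of `-Δ_±` and its action on `L²` distributions. -/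

variable {n : ℕ}

/-- The Fourier symbol `4π² ∑ εᵢ ξᵢ²` of `-Δ_±`. -/
def symbol (ε : Fin n → ℝ) (ξ : Space n) : ℝ := 4 * Real.pi ^ 2 * ∑ i, ε i * ξ i ^ 2

lemma contDiff_symbol (ε : Fin n → ℝ) : ContDiff ℝ (⊤ : ℕ∞) (symbol ε) := by
  unfold symbol
  fun_prop

lemma continuous_symbol (ε : Fin n → ℝ) : Continuous (symbol ε) := (contDiff_symbol ε).continuous

lemma hasTemperateGrowth_symbol (ε : Fin n → ℝ) :
    Function.HasTemperateGrowth fun ξ : Space n => (symbol ε ξ : ℂ) := by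
  have h : ∀ i, Function.HasTemperateGrowth fun ξ : Space n => ξ i := fun i =>
    (EuclideanSpace.proj (𝕜 := ℝ) i).hasTemperateGrowth
  have h' : Function.HasTemperateGrowth (symbol ε) := by
    unfold symbol
    exact (Function.HasTemperateGrowth.const _).mul <|
      Function.HasTemperateGrowth.sum fun i _ =>
        (Function.HasTemperateGrowth.const _).mul ((h i).pow 2)
  exact Complex.ofRealCLM.hasTemperateGrowth.comp h'

lemma abs_symbol_le (ε : Fin n → ℝ) :
    ∃ K : ℝ, 0 ≤ K ∧ ∀ ξ : Space n, |symbol ε ξ| ≤ K * (1 + ‖ξ‖) ^ 2 := by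
  refine ⟨4 * Real.pi ^ 2 * ∑ i, |ε i|, by positivity, fun ξ => ?_⟩
  rw [symbol, abs_mul, abs_of_nonneg (by positivity), mul_assoc _ (∑ i, |ε i|), Finset.sum_mul]
  gcongr
  refine (Finset.abs_sum_le_sum_abs _ _).trans (Finset.sum_le_sum fun i _ => ?_)
  rw [abs_mul, abs_pow]
  gcongr
  have : |ξ i| ≤ ‖ξ‖ := by simpa using PiLp.norm_apply_le ξ i
  linarith

section Distributions

/-- Every pairing is moved to the frequency side through this identity, where differential operators
become multiplications. -/
lemma toTemperedDistribution_apply_eq (v : Lp ℂ 2 (volume : Measure (Space n)))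
    (φ : 𝓢(Space n, ℂ)) :
    Lp.toTemperedDistribution v φ = ∫ ξ, (𝓕⁻ φ : 𝓢(Space n, ℂ)) ξ * (𝓕 v : Lp ℂ 2 (volume : Measure (Space n))) ξ := by
  have h : Lp.toTemperedDistribution v φ = Lp.toTemperedDistribution (𝓕 v) (𝓕⁻ φ) := by
    rw [← Lp.fourier_toTemperedDistribution_eq, TemperedDistribution.fourier_apply,
      FourierTransform.fourier_fourierInv_eq]
  rw [h, Lp.toTemperedDistribution_apply]
  rfl

open LineDeriv in
lemma fourierInv_lineDerivOp_lineDerivOp_apply (φ : 𝓢(Space n, ℂ)) (m ξ : Space n) :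
    (𝓕⁻ (∂_{m} (∂_{m} φ)) : 𝓢(Space n, ℂ)) ξ = -(4 * Real.pi ^ 2 * (inner ℝ ξ m : ℝ) ^ 2 : ℂ) * (𝓕⁻ φ : 𝓢(Space n, ℂ)) ξ := by
  have h : (fun ξ : Space n => inner ℝ ξ m).HasTemperateGrowth := by fun_prop
  rw [SchwartzMap.fourierInv_lineDerivOp_eq, SchwartzMap.fourierInv_lineDerivOp_eq]
  simp only [smul_apply, SchwartzMap.smulLeftCLM_apply_apply h, smul_eq_mul,
    Complex.real_smul]
  linear_combination (4 * Real.pi ^ 2 * (inner ℝ ξ m : ℝ) ^ 2 * (𝓕⁻ φ : 𝓢(Space n, ℂ)) ξ) * Complex.I_sq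

-- Each second derivative passes to the test function, the two signs cancelling, and there it acts
-- on the inverse transform as multiplication by `-4π² ξᵢ²`.
open LineDeriv in
lemma signedLaplacian_apply (ε : Fin n → ℝ) (v : Lp ℂ 2 (volume : Measure (Space n)))
    (φ : 𝓢(Space n, ℂ)) :
    signedLaplacian ε (Lp.toTemperedDistribution v) φ
      = -∫ ξ, symbol ε ξ * (𝓕⁻ φ : 𝓢(Space n, ℂ)) ξ * (𝓕 v : Lp ℂ 2 (volume : Measure (Space n))) ξ := by
  set M : Fin n → 𝓢(Space n, ℂ) := fun i =>
    ∂_{EuclideanSpace.single i (1 : ℝ)} (∂_{EuclideanSpace.single i (1 : ℝ)} φ) with hM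
  set L : 𝓢(Space n, ℂ) := ∑ i, (ε i : ℂ) • M i with hL
  have h1 : signedLaplacian ε (Lp.toTemperedDistribution v) φ = Lp.toTemperedDistribution v L := by
    rw [hL, map_sum, signedLaplacian]
    simp only [sum_apply, map_smul]
    refine Finset.sum_congr rfl fun i _ => ?_
    rw [smul_apply]
    congr 1
    rw [TemperedDistribution.lineDerivOp_apply_apply, TemperedDistribution.lineDerivOp_apply_apply]
    simp only [LineDeriv.lineDerivOp_neg, neg_neg, hM]
  have h2 : ∀ ξ, (𝓕⁻ L : 𝓢(Space n, ℂ)) ξ = -(symbol ε ξ * (𝓕⁻ φ : 𝓢(Space n, ℂ)) ξ) := by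
    intro ξ
    have hM' : ∀ i, (𝓕⁻ (M i) : 𝓢(Space n, ℂ)) ξ = _ := fun i =>
      fourierInv_lineDerivOp_lineDerivOp_apply φ (EuclideanSpace.single i (1 : ℝ)) ξ
    have : FourierTransform.fourierInvCLM ℂ 𝓢(Space n, ℂ) L
        = ∑ i, (ε i : ℂ) • FourierTransform.fourierInvCLM ℂ 𝓢(Space n, ℂ) (M i) := by
      simp only [hL, map_sum, map_smul]
    rw [show (𝓕⁻ L : 𝓢(Space n, ℂ)) = FourierTransform.fourierInvCLM ℂ 𝓢(Space n, ℂ) L from rfl,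
      this, sum_apply]
    simp only [smul_apply, FourierTransform.fourierInvCLM_apply, hM', symbol]
    push_cast
    rw [Finset.mul_sum, Finset.sum_mul, ← Finset.sum_neg_distrib]
    refine Finset.sum_congr rfl fun i _ => ?_
    rw [real_inner_comm, EuclideanSpace.inner_single_left]
    simp
    ring
  rw [h1, toTemperedDistribution_apply_eq, ← integral_neg]
  simp only [h2, neg_mul]

end Distributions

/-! ### Existence: the Duhamel solution. -/

section Existence

variable {F : ℝ → Space n → ℂ}

lemma memLp_duhamel (ε : Fin n → ℝ) (hF : IsDecaying F) (t : ℝ) :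
    MemLp (duhamel (symbol ε) F t) 2 := by
  obtain ⟨C, -, h⟩ := exists_norm_duhamel_le (symbol ε) hF (Module.finrank ℝ (Space n) + 1)
  exact memLp_of_le_decayWeight (continuous_duhamel_right hF (continuous_symbol ε) t).aestronglyMeasurable (Nat.lt_succ_self _) (h t)

/-- The solution given by Duhamel's formula. -/
def solution (ε : Fin n → ℝ) (hF : IsDecaying F) (t : ℝ) : Lp ℂ 2 (volume : Measure (Space n)) :=
  𝓕⁻ ((memLp_duhamel ε hF t).toLp _)

lemma fourier_solution (ε : Fin n → ℝ) (hF : IsDecaying F) (t : ℝ) :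
    𝓕 (solution ε hF t) = (memLp_duhamel ε hF t).toLp _ :=
  FourierTransform.fourier_fourierInv_eq _

lemma toTemperedDistribution_solution_apply (ε : Fin n → ℝ) (hF : IsDecaying F) (t : ℝ)
    (φ : 𝓢(Space n, ℂ)) :
    Lp.toTemperedDistribution (solution ε hF t) φ
      = ∫ ξ, (𝓕⁻ φ : 𝓢(Space n, ℂ)) ξ * duhamel (symbol ε) F t ξ := by
  rw [toTemperedDistribution_apply_eq, fourier_solution]
  refine integral_congr_ae ?_
  filter_upwards [(memLp_duhamel ε hF t).coeFn_toLp] with ξ hξ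
  rw [hξ]

lemma exists_norm_symbol_mul_duhamel_le (ε : Fin n → ℝ) (hF : IsDecaying F) (N : ℕ) :
    ∃ C : ℝ, 0 ≤ C ∧ ∀ t ξ, ‖symbol ε ξ * duhamel (symbol ε) F t ξ‖ ≤ C * decayWeight N ξ := by
  obtain ⟨K, hK, hq⟩ := abs_symbol_le ε
  obtain ⟨C, hC, h⟩ := exists_norm_duhamel_le (symbol ε) hF (2 + N)
  refine ⟨K * C, by positivity, fun t ξ => ?_⟩
  rw [norm_mul, Complex.norm_real, Real.norm_eq_abs]
  calc _ ≤ K * (1 + ‖ξ‖) ^ 2 * (C * decayWeight (2 + N) ξ) := by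
        gcongr
        · exact hq ξ
        · exact h t ξ
    _ = K * C * ((1 + ‖ξ‖) ^ 2 * decayWeight (2 + N) ξ) := by ring
    _ ≤ _ := by
        gcongr
        exact pow_mul_decayWeight_le 2 N ξ

/-- A bound for the time derivative that is uniform in `t`: it gives the Lipschitz continuity of the
solution in `L²` and the domination needed to differentiate pairings under the integral. -/
lemma exists_norm_deriv_duhamel_le (ε : Fin n → ℝ) (hF : IsDecaying F) (N : ℕ) :
    ∃ C : ℝ, 0 ≤ C ∧ ∀ t ξ, ‖-Complex.I * (symbol ε ξ * duhamel (symbol ε) F t ξ)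
      - Complex.I * 𝓕 (F t) ξ‖ ≤ C * decayWeight N ξ := by
  obtain ⟨C₁, hC₁, h₁⟩ := exists_norm_symbol_mul_duhamel_le ε hF N
  obtain ⟨C₂, hC₂, h₂⟩ := hF.fourier_bound N
  refine ⟨C₁ + C₂, by positivity, fun t ξ => ?_⟩
  refine (norm_sub_le _ _).trans ?_
  rw [norm_mul (-Complex.I), norm_mul Complex.I, norm_neg, Complex.norm_I, one_mul, one_mul, add_mul]
  refine add_le_add (h₁ t ξ) ((h₂ t ξ).trans ?_)
  gcongr
  exact mul_le_of_le_one_left (decayWeight_nonneg N ξ) (decayWeight_le_one 2 t)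

/-- The mean value inequality at each frequency bounds the difference at two times by `|t - t'|`
times a fixed square-integrable weight. So the transform is Lipschitz into `L²`, and the inverse
transform is an isometry. -/
lemma continuous_solution (ε : Fin n → ℝ) (hF : IsDecaying F) : Continuous (solution ε hF) := by
  set N := Module.finrank ℝ (Space n) + 1
  obtain ⟨C, hC, h⟩ := exists_norm_deriv_duhamel_le ε hF N
  have hw : MemLp (fun ξ : Space n => (decayWeight N ξ : ℂ)) 2 := by
    refine memLp_of_le_decayWeight (N := N) (C := 1)
      (Complex.continuous_ofReal.comp (continuous_decayWeight N)).aestronglyMeasurable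
      (Nat.lt_succ_self _) fun ξ => ?_
    rw [Complex.norm_real, Real.norm_of_nonneg (decayWeight_nonneg N ξ), one_mul]
  have hlip : ∀ t t' : ℝ, ‖(memLp_duhamel ε hF t).toLp _ - (memLp_duhamel ε hF t').toLp _‖
      ≤ C * ‖hw.toLp _‖ * ‖t - t'‖ := by
    intro t t'
    rw [← MemLp.toLp_sub]
    have : C * ‖hw.toLp _‖ * ‖t - t'‖ = C * ‖t - t'‖ * ‖hw.toLp _‖ := by ring
    rw [this]
    refine Lp.norm_le_mul_norm_of_ae_le_mul ?_
    filter_upwards [((memLp_duhamel ε hF t).sub (memLp_duhamel ε hF t')).coeFn_toLp,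
      hw.coeFn_toLp] with ξ h1 h2
    rw [h1, h2, Complex.norm_real, Real.norm_of_nonneg (decayWeight_nonneg N ξ)]
    have := (convex_univ (𝕜 := ℝ) (E := ℝ)).norm_image_sub_le_of_norm_hasDerivWithin_le
      (f := fun t => duhamel (symbol ε) F t ξ) (C := C * decayWeight N ξ)
      (fun s _ => (hasDerivAt_duhamel hF ξ s).hasDerivWithinAt) (fun s _ => h s ξ)
      (Set.mem_univ t') (Set.mem_univ t)
    refine this.trans_eq (by ring)
  refine (Lp.fourierTransformₗᵢ (Space n) ℂ).symm.continuous.comp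
    (LipschitzWith.of_dist_le_mul (K := (C * ‖hw.toLp _‖).toNNReal) fun t t' => ?_).continuous
  rw [dist_eq_norm, dist_eq_norm, Real.coe_toNNReal _ (by positivity)]
  exact hlip t t'

lemma solution_zero (ε : Fin n → ℝ) (hF : IsDecaying F) : solution ε hF 0 = 0 := by
  have h : (memLp_duhamel ε hF 0).toLp _ = 0 := by
    rw [Lp.eq_zero_iff_ae_eq_zero]
    filter_upwards [(memLp_duhamel ε hF 0).coeFn_toLp] with ξ hξ
    rw [hξ, duhamel_zero_left]
    rfl
  rw [solution, h]
  exact (Lp.fourierTransformₗᵢ (Space n) ℂ).symm.map_zero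

lemma hasDerivAt_integral_mul_duhamel (ε : Fin n → ℝ) (hF : IsDecaying F) {ψ : Space n → ℂ}
    (hψ : Continuous ψ) (hψi : Integrable ψ) (t : ℝ) :
    HasDerivAt (fun t => ∫ ξ, ψ ξ * duhamel (symbol ε) F t ξ)
      (∫ ξ, ψ ξ * (-Complex.I * (symbol ε ξ * duhamel (symbol ε) F t ξ)
        - Complex.I * 𝓕 (F t) ξ)) t := by
  obtain ⟨C, hC, h⟩ := exists_norm_deriv_duhamel_le ε hF 0
  obtain ⟨C', hC', h'⟩ := exists_norm_duhamel_le (symbol ε) hF 0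
  have hd := continuous_duhamel_right hF (continuous_symbol ε)
  have hf := hF.continuous_fourier_right t
  have hq : Continuous fun ξ => (symbol ε ξ : ℂ) :=
    Complex.continuous_ofReal.comp (continuous_symbol ε)
  have hmeas : ∀ᶠ t in nhds t, AEStronglyMeasurable
      (fun ξ => ψ ξ * duhamel (symbol ε) F t ξ) volume :=
    .of_forall fun t => (hψ.mul (hd t)).aestronglyMeasurable
  have hint : Integrable fun ξ => ψ ξ * duhamel (symbol ε) F t ξ := by
    refine hψi.mul_bdd (c := C') (hd t).aestronglyMeasurable (.of_forall fun ξ => ?_)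
    simpa only [decayWeight_zero_left, mul_one] using h' t ξ
  have hmeas' : AEStronglyMeasurable (fun ξ => ψ ξ * (-Complex.I *
      (symbol ε ξ * duhamel (symbol ε) F t ξ) - Complex.I * 𝓕 (F t) ξ)) volume :=
    (hψ.mul ((continuous_const.mul (hq.mul (hd t))).sub
      (continuous_const.mul hf))).aestronglyMeasurable
  refine (hasDerivAt_integral_of_dominated_loc_of_deriv_le (s := Set.univ) Filter.univ_mem
    (bound := fun ξ => ‖ψ ξ‖ * C) (F' := fun t ξ => ψ ξ * (-Complex.I *
      (symbol ε ξ * duhamel (symbol ε) F t ξ) - Complex.I * 𝓕 (F t) ξ)) hmeas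
    hint hmeas' (.of_forall fun ξ t _ => ?_) (hψi.norm.mul_const C)
    (.of_forall fun ξ t _ => ?_)).2
  · rw [norm_mul]
    gcongr
    simpa only [decayWeight_zero_left, mul_one] using h t ξ
  · exact (hasDerivAt_duhamel hF ξ t).const_mul _

lemma isSolution_solution (ε : Fin n → ℝ) (F : 𝓢(ℝ × Space n, ℂ)) :
    IsSolution ε F (solution ε (isDecaying_of_schwartz F)) := by
  set hF := isDecaying_of_schwartz F
  have hder : ∀ (φ : 𝓢(Space n, ℂ)) t, HasDerivAt
      (fun t => Lp.toTemperedDistribution (solution ε hF t) φ) _ t := fun φ t =>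
    (hasDerivAt_integral_mul_duhamel ε hF (𝓕⁻ φ : 𝓢(Space n, ℂ)).continuous
      (𝓕⁻ φ : 𝓢(Space n, ℂ)).integrable t).congr_of_eventuallyEq
      (.of_forall fun t => toTemperedDistribution_solution_apply ε hF t φ)
  refine ⟨continuous_solution ε hF, solution_zero ε hF, fun φ t => (hder φ t).differentiableAt,
    fun φ t => ?_⟩
  rw [(hder φ t).deriv, signedLaplacian_apply, fourier_solution]
  have h1 : ∫ ξ, symbol ε ξ * (𝓕⁻ φ : 𝓢(Space n, ℂ)) ξ *
      ((memLp_duhamel ε hF t).toLp _ : Lp ℂ 2 (volume : Measure (Space n))) ξ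
      = ∫ ξ, symbol ε ξ * (𝓕⁻ φ : 𝓢(Space n, ℂ)) ξ * duhamel (symbol ε) (fun t x => F (t, x)) t ξ := by
    refine integral_congr_ae ?_
    filter_upwards [(memLp_duhamel ε hF t).coeFn_toLp] with ξ hξ
    rw [hξ]
  -- The source term is moved to the frequency side as well, so that the equation becomes the
  -- differential equation of `duhamel` integrated against the inverse transform of `φ`.
  have h2 : ∫ x, φ x * F (t, x) = ∫ ξ, (𝓕⁻ φ : 𝓢(Space n, ℂ)) ξ * 𝓕 (fun x => F (t, x)) ξ := by
    rw [← integral_fourier_mul_comm (𝓕⁻ φ : 𝓢(Space n, ℂ)).integrable (hF.integrable_apply t),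
      ← SchwartzMap.fourier_coe, FourierTransform.fourier_fourierInv_eq]
  have hψi : Integrable (𝓕⁻ φ : 𝓢(Space n, ℂ)) := (𝓕⁻ φ : 𝓢(Space n, ℂ)).integrable
  have hi₁ : Integrable fun ξ => (𝓕⁻ φ : 𝓢(Space n, ℂ)) ξ *
      (symbol ε ξ * duhamel (symbol ε) (fun t x => F (t, x)) t ξ) := by
    obtain ⟨C, -, hC⟩ := exists_norm_symbol_mul_duhamel_le ε hF 0
    refine hψi.mul_bdd (c := C) (Continuous.aestronglyMeasurable ?_) (.of_forall fun ξ => ?_)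
    · exact (Complex.continuous_ofReal.comp (continuous_symbol ε)).mul
        (continuous_duhamel_right hF (continuous_symbol ε) t)
    · simpa only [decayWeight_zero_left, mul_one] using hC t ξ
  have hi₂ : Integrable fun ξ => (𝓕⁻ φ : 𝓢(Space n, ℂ)) ξ * 𝓕 (fun x => F (t, x)) ξ := by
    obtain ⟨C, -, hC⟩ := hF.fourier_bound 0
    refine hψi.mul_bdd (c := C * decayWeight 2 t)
      (hF.continuous_fourier_right t).aestronglyMeasurable
      (.of_forall fun ξ => ?_)
    simpa only [decayWeight_zero_left, mul_one] using hC t ξ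
  have h3 : ∫ ξ, (𝓕⁻ φ : 𝓢(Space n, ℂ)) ξ * (-Complex.I *
      (symbol ε ξ * duhamel (symbol ε) (fun t x => F (t, x)) t ξ)
        - Complex.I * 𝓕 (fun x => F (t, x)) ξ)
      = -Complex.I * (∫ ξ, (𝓕⁻ φ : 𝓢(Space n, ℂ)) ξ *
        (symbol ε ξ * duhamel (symbol ε) (fun t x => F (t, x)) t ξ))
        - Complex.I * ∫ ξ, (𝓕⁻ φ : 𝓢(Space n, ℂ)) ξ * 𝓕 (fun x => F (t, x)) ξ := by
    rw [← integral_const_mul, ← integral_const_mul,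
      ← integral_sub (hi₁.const_mul _) (hi₂.const_mul _)]
    refine integral_congr_ae (.of_forall fun ξ => ?_)
    ring
  have h4 : ∫ ξ, symbol ε ξ * (𝓕⁻ φ : 𝓢(Space n, ℂ)) ξ *
      duhamel (symbol ε) (fun t x => F (t, x)) t ξ
      = ∫ ξ, (𝓕⁻ φ : 𝓢(Space n, ℂ)) ξ *
        (symbol ε ξ * duhamel (symbol ε) (fun t x => F (t, x)) t ξ) := by
    refine integral_congr_ae (.of_forall fun ξ => ?_)
    ring
  rw [h1, h2, h3, h4]
  linear_combination (-(∫ ξ, (𝓕⁻ φ : 𝓢(Space n, ℂ)) ξ *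
    (symbol ε ξ * duhamel (symbol ε) (fun t x => F (t, x)) t ξ))
    - ∫ ξ, (𝓕⁻ φ : 𝓢(Space n, ℂ)) ξ * 𝓕 (fun x => F (t, x)) ξ) * Complex.I_sq

end Existence

/-! ### Uniqueness of weak solutions. -/

section Uniqueness

/-- The pairing `∫ ψ v̂` of a Schwartz function with the Fourier transform of an `L²` function. -/
def frequencyPairing (ψ : 𝓢(Space n, ℂ)) :
    Lp ℂ 2 (volume : Measure (Space n)) →ₗ[ℂ] ℂ where
  toFun v := Lp.toTemperedDistribution v (𝓕 ψ)
  map_add' v w := by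
    simp only [← Lp.toTemperedDistributionCLM_apply, map_add, add_apply]
  map_smul' c v := by
    simp only [← Lp.toTemperedDistributionCLM_apply, map_smul, smul_apply, RingHom.id_apply]

lemma frequencyPairing_eq_integral (ψ : 𝓢(Space n, ℂ)) (v : Lp ℂ 2 (volume : Measure (Space n))) :
    frequencyPairing ψ v = ∫ ξ, ψ ξ * (𝓕 v : Lp ℂ 2 (volume : Measure (Space n))) ξ := by
  have h := toTemperedDistribution_apply_eq v (𝓕 ψ)
  rw [FourierTransform.fourierInv_fourier_eq] at h
  exact h

lemma frequencyPairing_add (ψ χ : 𝓢(Space n, ℂ)) (v : Lp ℂ 2 (volume : Measure (Space n))) :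
    frequencyPairing (ψ + χ) v = frequencyPairing ψ v + frequencyPairing χ v := by
  show Lp.toTemperedDistribution v (𝓕 (ψ + χ)) = _
  rw [FourierTransform.fourier_add, map_add]
  rfl

lemma frequencyPairing_smul (c : ℂ) (ψ : 𝓢(Space n, ℂ))
    (v : Lp ℂ 2 (volume : Measure (Space n))) :
    frequencyPairing (c • ψ) v = c * frequencyPairing ψ v := by
  show Lp.toTemperedDistribution v (𝓕 (c • ψ)) = _
  rw [FourierTransform.fourier_smul, map_smul]
  rfl

/-- Multiplication by the symbol. -/
def symbolMul (ε : Fin n → ℝ) (ψ : 𝓢(Space n, ℂ)) : 𝓢(Space n, ℂ) :=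
  SchwartzMap.smulLeftCLM ℂ (fun ξ : Space n => (symbol ε ξ : ℂ)) ψ

lemma symbolMul_apply (ε : Fin n → ℝ) (ψ : 𝓢(Space n, ℂ)) (ξ : Space n) :
    symbolMul ε ψ ξ = symbol ε ξ * ψ ξ := by
  rw [symbolMul, SchwartzMap.smulLeftCLM_apply_apply (hasTemperateGrowth_symbol ε), smul_eq_mul]

lemma signedLaplacian_apply_fourier (ε : Fin n → ℝ) (v : Lp ℂ 2 (volume : Measure (Space n)))
    (ψ : 𝓢(Space n, ℂ)) :
    signedLaplacian ε (Lp.toTemperedDistribution v) (𝓕 ψ)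
      = -frequencyPairing (symbolMul ε ψ) v := by
  rw [signedLaplacian_apply, frequencyPairing_eq_integral, FourierTransform.fourierInv_fourier_eq]
  simp only [symbolMul_apply]

/-- The constant `c` enters linearly: with `c = O((s - t) ^ 2)` and `g`, `‖v‖` under control, the
pairing with a second-order Taylor remainder is quadratically small. The elementary inequality `xy ≤
x² + y²` under the integral is enough. -/
lemma norm_frequencyPairing_le {ψ g : 𝓢(Space n, ℂ)} {c : ℝ} (hψ : ∀ ξ, ‖ψ ξ‖ ≤ c * ‖g ξ‖)
    (hc : 0 ≤ c) (v : Lp ℂ 2 (volume : Measure (Space n))) :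
    ‖frequencyPairing ψ v‖ ≤ c * (‖g.toLp 2‖ ^ 2 + ‖v‖ ^ 2) := by
  set V : Lp ℂ 2 (volume : Measure (Space n)) := 𝓕 v
  have hV : ‖V‖ = ‖v‖ := Lp.norm_fourier_eq v
  have hsq : ∀ f : Lp ℂ 2 (volume : Measure (Space n)), ∫ ξ, ‖f ξ‖ ^ 2 = ‖f‖ ^ 2 := by
    intro f
    have := L2.inner_def (𝕜 := ℂ) f f
    rw [inner_self_eq_norm_sq_to_K] at this
    have h2 : ∀ ξ, inner ℂ (f ξ) (f ξ) = ((‖f ξ‖ ^ 2 : ℝ) : ℂ) := fun ξ => by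
      rw [inner_self_eq_norm_sq_to_K]; push_cast; rfl
    simp only [h2] at this
    rw [integral_complex_ofReal] at this
    refine Complex.ofReal_injective (this.symm.trans ?_)
    push_cast
    rfl
  have hg : ∫ ξ, ‖g ξ‖ ^ 2 = ‖g.toLp 2‖ ^ 2 := by
    rw [← hsq]
    refine integral_congr_ae ?_
    filter_upwards [g.coeFn_toLp 2 volume] with ξ hξ
    rw [hξ]
  have hgi : Integrable fun ξ => ‖g ξ‖ ^ 2 := (g.memLp 2).integrable_norm_pow (by norm_num)
  have hVi : Integrable fun ξ => ‖V ξ‖ ^ 2 := (Lp.memLp V).integrable_norm_pow (by norm_num)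
  rw [frequencyPairing_eq_integral, ← hg, ← hV, ← hsq V, ← integral_add hgi hVi,
    ← integral_const_mul]
  refine norm_integral_le_of_norm_le ((hgi.add hVi).const_mul c) (.of_forall fun ξ => ?_)
  rw [norm_mul]
  calc ‖ψ ξ‖ * ‖V ξ‖ ≤ c * ‖g ξ‖ * ‖V ξ‖ := by gcongr; exact hψ ξ
    _ = c * (‖g ξ‖ * ‖V ξ‖) := by ring
    _ ≤ _ := by
        gcongr
        nlinarith [sq_nonneg (‖g ξ‖ - ‖V ξ‖), sq_nonneg (‖g ξ‖ + ‖V ξ‖)]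

lemma IsSolution.hasDerivAt_frequencyPairing {ε : Fin n → ℝ} {F : 𝓢(ℝ × Space n, ℂ)}
    {u : ℝ → Lp ℂ 2 (volume : Measure (Space n))} (hu : IsSolution ε F u) (ψ : 𝓢(Space n, ℂ))
    (t : ℝ) :
    HasDerivAt (fun s => frequencyPairing ψ (u s)) (-Complex.I * frequencyPairing (symbolMul ε ψ) (u t)
      - Complex.I * ∫ x, (𝓕 ψ : 𝓢(Space n, ℂ)) x * F (t, x)) t := by
  have h1 := (hu.differentiable (𝓕 ψ) t).hasDerivAt
  have h2 := hu.equation (𝓕 ψ) t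
  rw [signedLaplacian_apply_fourier] at h2
  refine h1.congr_deriv ?_
  linear_combination (-Complex.I) * h2
    + deriv (fun s : ℝ => Lp.toTemperedDistribution (u s) (𝓕 ψ)) t * Complex.I_sq

lemma hasDerivAt_frequencyPairing_sub {ε : Fin n → ℝ} {F : 𝓢(ℝ × Space n, ℂ)}
    {u v : ℝ → Lp ℂ 2 (volume : Measure (Space n))} (hu : IsSolution ε F u)
    (hv : IsSolution ε F v) (ψ : 𝓢(Space n, ℂ)) (t : ℝ) :
    HasDerivAt (fun s => frequencyPairing ψ (u s - v s))
      (-Complex.I * frequencyPairing (symbolMul ε ψ) (u t - v t)) t := by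
  have := (hu.hasDerivAt_frequencyPairing ψ t).sub (hv.hasDerivAt_frequencyPairing ψ t)
  refine (this.congr_of_eventuallyEq (.of_forall fun s => ?_)).congr_deriv ?_
  · simp only [map_sub, Pi.sub_apply]
  · rw [map_sub]
    ring

/-- Taylor's formula for `|x| ≤ 1`, and the trivial bound `2 + |x| ≤ 3x²` beyond. The bound is
global, so it applies at all frequencies at once. -/
lemma norm_exp_I_mul_sub_one_sub_le (x : ℝ) :
    ‖Complex.exp (Complex.I * x) - 1 - Complex.I * x‖ ≤ 3 * x ^ 2 := by
  have hx : ‖Complex.I * x‖ = |x| := by simp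
  rcases le_total |x| 1 with h | h
  · refine (Complex.norm_exp_sub_one_sub_id_le (by rwa [hx])).trans ?_
    rw [hx, sq_abs]
    nlinarith [sq_nonneg x]
  · have h1 : ‖Complex.exp (Complex.I * x)‖ = 1 := by rw [Complex.norm_exp]; simp
    calc _ ≤ ‖Complex.exp (Complex.I * x)‖ + ‖(1 : ℂ)‖ + ‖Complex.I * x‖ :=
          (norm_sub_le _ _).trans (by gcongr; exact norm_sub_le _ _)
      _ = 2 + |x| := by rw [h1, hx, norm_one]; ring
      _ ≤ 3 * |x| ^ 2 := by nlinarith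
      _ = _ := by rw [sq_abs]

/-- A test function multiplied by the propagator `exp(i t q)`. -/
lemma exists_propagated {g : Space n → ℝ} (ε : Fin n → ℝ) (hg : ContDiff ℝ (⊤ : ℕ∞) g)
    (hgc : HasCompactSupport g) :
    ∃ χ : ℝ → 𝓢(Space n, ℂ), ∀ t ξ, χ t ξ = Complex.exp (Complex.I * (t * symbol ε ξ)) * g ξ := by
  have h1 : ∀ t : ℝ, HasCompactSupport fun ξ => Complex.exp (Complex.I * (t * symbol ε ξ)) * g ξ :=
    fun t => (hgc.comp_left (g := Complex.ofReal) rfl).mul_left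
  have h2 : ∀ t : ℝ, ContDiff ℝ (⊤ : ℕ∞)
      fun ξ => Complex.exp (Complex.I * (t * symbol ε ξ)) * g ξ := by
    intro t
    have h3 : ContDiff ℝ (⊤ : ℕ∞) fun ξ => (symbol ε ξ : ℂ) :=
      Complex.ofRealCLM.contDiff.comp (contDiff_symbol ε)
    have h4 : ContDiff ℝ (⊤ : ℕ∞) fun ξ => (g ξ : ℂ) := Complex.ofRealCLM.contDiff.comp hg
    exact (contDiff_const.mul (contDiff_const.mul h3)).cexp.mul h4
  exact ⟨fun t => (h1 t).toSchwartzMap (h2 t), fun t ξ => rfl⟩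

/-- Continuous `L²`-valued weak solutions of the homogeneous equation with zero initial value
vanish. -/
lemma eq_zero_of_hasDerivAt_frequencyPairing {ε : Fin n → ℝ}
    {w : ℝ → Lp ℂ 2 (volume : Measure (Space n))} (hw : Continuous w) (h0 : w 0 = 0)
    (hder : ∀ (ψ : 𝓢(Space n, ℂ)) t, HasDerivAt (fun s => frequencyPairing ψ (w s))
      (-Complex.I * frequencyPairing (symbolMul ε ψ) (w t)) t) (T : ℝ) : w T = 0 := by
  have key : ∀ g : Space n → ℝ, ContDiff ℝ (⊤ : ℕ∞) g → HasCompactSupport g →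
      ∫ ξ, g ξ • (𝓕 (w T) : Lp ℂ 2 (volume : Measure (Space n))) ξ = 0 := by
    intro g hg hgc
    obtain ⟨χ, hχ⟩ := exists_propagated ε hg hgc
    -- At `s = T` this is the pairing with `g` itself, at `s = 0` it vanishes, and it is shown to be
    -- constant.
    set b : ℝ → ℂ := fun s => frequencyPairing (χ (s - T)) (w s) with hb
    have hb' : ∀ t, HasDerivAt b 0 t := by
      intro t
      set χt := χ (t - T) with hχt
      set G : 𝓢(Space n, ℂ) := symbolMul ε (symbolMul ε χt) with hG
      -- The first-order Taylor remainder at `s = t` of the moving test function. Subtracting it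
      -- leaves only fixed test functions, for which the weak equation gives the derivative.
      set ρ : ℝ → 𝓢(Space n, ℂ) := fun s =>
        χ (s - T) + (-1 : ℂ) • χt + (-(Complex.I * (s - t : ℝ))) • symbolMul ε χt with hρ
      have hρ_le : ∀ s ξ, ‖ρ s ξ‖ ≤ 3 * (s - t) ^ 2 * ‖G ξ‖ := by
        intro s ξ
        have e1 : ρ s ξ = (Complex.exp (Complex.I * ((s - t) * symbol ε ξ : ℝ)) - 1
            - Complex.I * ((s - t) * symbol ε ξ : ℝ)) * χt ξ := by
          simp only [hρ, add_apply, smul_apply, smul_eq_mul, symbolMul_apply, hχt, hχ]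
          have : Complex.exp (Complex.I * ((s - T : ℝ) * symbol ε ξ))
              = Complex.exp (Complex.I * ((s - t) * symbol ε ξ : ℝ))
                * Complex.exp (Complex.I * ((t - T : ℝ) * symbol ε ξ)) := by
            rw [← Complex.exp_add]
            congr 1
            push_cast
            ring
          rw [this]
          push_cast
          ring
        have e2 : ‖G ξ‖ = symbol ε ξ ^ 2 * ‖χt ξ‖ := by
          rw [hG, symbolMul_apply, symbolMul_apply, norm_mul, norm_mul, Complex.norm_real,
            ← mul_assoc, ← sq, Real.norm_eq_abs, sq_abs]
        rw [e1, e2, norm_mul]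
        calc _ ≤ 3 * ((s - t) * symbol ε ξ) ^ 2 * ‖χt ξ‖ := by
              gcongr
              exact norm_exp_I_mul_sub_one_sub_le _
          _ = _ := by ring
      have hρ' : HasDerivAt (fun s => frequencyPairing (ρ s) (w s)) 0 t := by
        have hO : (fun s => frequencyPairing (ρ s) (w s)) =O[nhds t] fun s => ‖s - t‖ ^ 2 := by
          refine Asymptotics.IsBigO.of_bound (3 * (‖G.toLp 2‖ ^ 2 + (‖w t‖ + 1) ^ 2)) ?_
          -- Continuity of `w` enters only through local boundedness of its norm.
          have hev : ∀ᶠ s in nhds t, ‖w s‖ < ‖w t‖ + 1 :=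
            hw.norm.continuousAt.eventually_lt continuousAt_const (by simp)
          filter_upwards [hev] with s hs
          refine (norm_frequencyPairing_le (hρ_le s) (by positivity) (w s)).trans ?_
          rw [norm_pow, norm_norm, Real.norm_eq_abs, sq_abs]
          calc _ ≤ 3 * (s - t) ^ 2 * (‖G.toLp 2‖ ^ 2 + (‖w t‖ + 1) ^ 2) := by gcongr
            _ = _ := by ring
        simpa using (hO.hasFDerivAt (by norm_num)).hasDerivAt
      have hsplit : ∀ s, b s = frequencyPairing (ρ s) (w s) + frequencyPairing χt (w s)
          + Complex.I * (s - t : ℝ) * frequencyPairing (symbolMul ε χt) (w s) := by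
        intro s
        simp only [hb, hρ, frequencyPairing_add, frequencyPairing_smul]
        ring
      have hlin : HasDerivAt (fun s : ℝ => Complex.I * ((s - t : ℝ) : ℂ)) (Complex.I * 1) t :=
        (((hasDerivAt_id t).sub_const t).ofReal_comp).const_mul Complex.I
      -- The equation contributes `-i⟨qχ, w⟩` and the linear term of the moving test function
      -- contributes `i⟨qχ, w⟩`; they cancel.
      have := (hρ'.add (hder χt t)).add (hlin.mul (hder (symbolMul ε χt) t))
      refine (this.congr_of_eventuallyEq (.of_forall fun s => ?_)).congr_deriv ?_
      · exact hsplit s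
      · simp
    have hconst : b T = b 0 :=
      is_const_of_deriv_eq_zero (fun t => (hb' t).differentiableAt) (fun t => (hb' t).deriv) T 0
    have hz : b 0 = 0 := by simp only [hb, h0, map_zero]
    rw [hz] at hconst
    simp only [hb, frequencyPairing_eq_integral, hχ] at hconst
    simpa using hconst
  have hloc : LocallyIntegrable (𝓕 (w T) : Lp ℂ 2 (volume : Measure (Space n))) volume :=
    (Lp.memLp _).locallyIntegrable (by norm_num)
  have hzero : 𝓕 (w T) = 0 :=
    (Lp.eq_zero_iff_ae_eq_zero).mpr (ae_eq_zero_of_integral_contDiff_smul_eq_zero hloc key)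
  rw [← norm_eq_zero, ← Lp.norm_fourier_eq, hzero, norm_zero]

lemma IsSolution.unique {ε : Fin n → ℝ} {F : 𝓢(ℝ × Space n, ℂ)}
    {u v : ℝ → Lp ℂ 2 (volume : Measure (Space n))} (hu : IsSolution ε F u)
    (hv : IsSolution ε F v) : u = v := by
  funext T
  rw [← sub_eq_zero]
  exact eq_zero_of_hasDerivAt_frequencyPairing (w := fun t => u t - v t)
    (hu.continuous.sub hv.continuous) (by simp [hu.initial, hv.initial])
    (hasDerivAt_frequencyPairing_sub hu hv) T

end Uniqueness

/-! ### The one-dimensional equation with quadratic symbol: Laplace transform in time. -/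

section OneDimensional

/-- A quadratic symbol on the line. -/
def quadratic (a b c η : ℝ) : ℝ := 4 * Real.pi ^ 2 * (a * η ^ 2 + 2 * b * η + c)

lemma continuous_quadratic (a b c : ℝ) : Continuous (quadratic a b c) := by
  unfold quadratic
  fun_prop

lemma quadratic_neg (a b c η : ℝ) : quadratic (-a) (-b) (-c) η = -quadratic a b c η := by
  unfold quadratic
  ring

/-- For the solution `u` of `(i∂ₜ - q(D)) u = k`, `u(0) = 0` on the line with quadratic symbol `q`,
the function `q'(D) u / 4π`. -/
def velocityField (a b c : ℝ) (k : ℝ → ℝ → ℂ) (t r : ℝ) : ℂ :=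
  𝓕⁻ (fun η : ℝ => (2 * Real.pi * (a * η + b) : ℂ) * duhamel (quadratic a b c) k t η) r

variable {k : ℝ → ℝ → ℂ} (a b c : ℝ)

lemma exists_norm_velocity_duhamel_le (hk : IsDecaying k) :
    ∃ C : ℝ, 0 ≤ C ∧ ∀ t η : ℝ,
      ‖(2 * Real.pi * (a * η + b) : ℂ) * duhamel (quadratic a b c) k t η‖ ≤ C * decayWeight 2 η := by
  -- One power of decay absorbs the linear factor, and the remaining two keep the bound integrable
  -- on the line.
  obtain ⟨C, hC, h⟩ := exists_norm_duhamel_le (quadratic a b c) hk (1 + 2)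
  refine ⟨2 * Real.pi * (|a| + |b|) * C, by positivity, fun t η => ?_⟩
  have h1 : ‖(2 * Real.pi * (a * η + b) : ℂ)‖ ≤ 2 * Real.pi * (|a| + |b|) * (1 + ‖η‖) ^ 1 := by
    have : (2 * Real.pi * (a * η + b) : ℂ) = ((2 * Real.pi * (a * η + b) : ℝ) : ℂ) := by push_cast; rfl
    rw [this, Complex.norm_real, Real.norm_eq_abs, abs_mul, abs_of_pos (by positivity),
      mul_assoc (2 * Real.pi), pow_one, Real.norm_eq_abs]
    refine mul_le_mul_of_nonneg_left ?_ (by positivity)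
    calc |a * η + b| ≤ |a| * |η| + |b| := (abs_add_le _ _).trans (by rw [abs_mul])
      _ ≤ (|a| + |b|) * (1 + |η|) := by nlinarith [abs_nonneg a, abs_nonneg b, abs_nonneg η]
  rw [norm_mul]
  calc _ ≤ 2 * Real.pi * (|a| + |b|) * (1 + ‖η‖) ^ 1 * (C * decayWeight (1 + 2) η) := by
        gcongr
        exact h t η
    _ = 2 * Real.pi * (|a| + |b|) * C * ((1 + ‖η‖) ^ 1 * decayWeight (1 + 2) η) := by ring
    _ ≤ _ := by
        gcongr
        exact pow_mul_decayWeight_le 1 2 η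

lemma continuous_velocity_duhamel (hk : IsDecaying k) : Continuous fun z : ℝ × ℝ =>
    (2 * Real.pi * (a * z.2 + b) : ℂ) * duhamel (quadratic a b c) k z.1 z.2 :=
  (by fun_prop : Continuous fun z : ℝ × ℝ => (2 * Real.pi * (a * z.2 + b) : ℂ)).mul
    (continuous_duhamel hk (continuous_quadratic a b c))

lemma integrable_decayWeight_two : Integrable (decayWeight 2 : ℝ → ℝ) :=
  integrable_decayWeight (by simp)

lemma norm_exp_mul_I_eq_one (x : ℂ) (hx : x.im = 0) : ‖Complex.exp (x * Complex.I)‖ = 1 := by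
  rw [Complex.norm_exp]
  simp [hx]

lemma continuous_velocityField (hk : IsDecaying k) (r : ℝ) :
    Continuous fun t => velocityField a b c k t r := by
  obtain ⟨C, hC, h⟩ := exists_norm_velocity_duhamel_le a b c hk
  simp only [velocityField, fourierInv_real_eq]
  have he : ∀ η : ℝ, ‖Complex.exp (2 * Real.pi * η * r * Complex.I)‖ = 1 := fun η =>
    norm_exp_mul_I_eq_one _ (by simp)
  refine continuous_of_dominated (bound := fun η => C * decayWeight 2 η) (fun t => ?_)
    (fun t => .of_forall fun η => ?_) (integrable_decayWeight_two.const_mul C)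
    (.of_forall fun η => ?_)
  · exact ((by fun_prop : Continuous fun η : ℝ => Complex.exp (2 * Real.pi * η * r * Complex.I)).mul
      ((by fun_prop : Continuous fun η : ℝ => (2 * Real.pi * (a * η + b) : ℂ)).mul
        (continuous_duhamel_right hk (continuous_quadratic a b c) t))).aestronglyMeasurable
  · rw [norm_mul, he, one_mul]
    exact h t η
  · exact continuous_const.mul (continuous_const.mul
      ((continuous_duhamel hk (continuous_quadratic a b c)).uncurry_right η))

lemma exists_norm_velocityField_le (hk : IsDecaying k) :
    ∃ C : ℝ, 0 ≤ C ∧ ∀ t r, ‖velocityField a b c k t r‖ ≤ C := by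
  obtain ⟨C, hC, h⟩ := exists_norm_velocity_duhamel_le a b c hk
  refine ⟨∫ η : ℝ, C * decayWeight 2 η,
    integral_nonneg fun η => mul_nonneg hC (decayWeight_nonneg _ _), fun t r => ?_⟩
  rw [velocityField, fourierInv_real_eq]
  refine norm_integral_le_of_norm_le (integrable_decayWeight_two.const_mul C)
    (.of_forall fun η => ?_)
  rw [norm_mul, norm_exp_mul_I_eq_one _ (by simp), one_mul]
  exact h t η

lemma norm_exp_neg_mul_le_one {z : ℂ} (hz : 0 < z.re) {t : ℝ} (ht : 0 < t) :
    ‖Complex.exp (-z * t)‖ ≤ 1 := by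
  rw [Complex.norm_exp, Real.exp_le_one_iff]
  simp
  positivity

/-- The Laplace transform in time of the source. -/
def laplaceSource (k : ℝ → ℝ → ℂ) (z : ℂ) (r : ℝ) : ℂ :=
  ∫ s in Set.Ioi (0 : ℝ), Complex.exp (-z * s) * k s r

lemma continuous_laplaceSource (hk : IsDecaying k) {z : ℂ} (hz : 0 < z.re) :
    Continuous (laplaceSource k z) := by
  obtain ⟨C, hC, h⟩ := hk.bound 0
  unfold laplaceSource
  refine continuous_of_dominated (bound := fun s => C * decayWeight 2 s) (fun r => ?_)
    (fun r => ?_) (integrable_decayWeight_two.const_mul C).integrableOn (.of_forall fun s => ?_)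
  · exact ((by fun_prop : Continuous fun s : ℝ => Complex.exp (-z * s)).mul
      (hk.continuous.comp (by fun_prop : Continuous fun s : ℝ => (s, r)))).aestronglyMeasurable
  · refine (ae_restrict_iff' measurableSet_Ioi).mpr (.of_forall fun s hs => ?_)
    rw [norm_mul]
    calc _ ≤ 1 * (C * (decayWeight 2 s * decayWeight 0 r)) := by
          gcongr
          · exact norm_exp_neg_mul_le_one hz hs
          · exact h s r
      _ = _ := by simp
  · exact continuous_const.mul (hk.continuous_apply s)

lemma integrable_laplaceSource_prod (hk : IsDecaying k) {z : ℂ} (hz : 0 < z.re) :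
    Integrable (fun w : ℝ × ℝ => Complex.exp (-z * w.1) * k w.1 w.2)
      ((volume.restrict (Set.Ioi 0)).prod volume) := by
  obtain ⟨C, hC, h⟩ := hk.bound 2
  have hmaj : Integrable (fun w : ℝ × ℝ => C * (decayWeight 2 w.1 * decayWeight 2 w.2))
      ((volume.restrict (Set.Ioi 0)).prod volume) :=
    (integrable_decayWeight_two.integrableOn.mul_prod integrable_decayWeight_two).const_mul C
  refine hmaj.mono' ?_ ?_
  · exact ((by fun_prop : Continuous fun w : ℝ × ℝ => Complex.exp (-z * w.1)).mul
      hk.continuous).aestronglyMeasurable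
  · have : ∀ᵐ w : ℝ × ℝ ∂((volume.restrict (Set.Ioi 0)).prod volume), w.1 ∈ Set.Ioi (0 : ℝ) :=
      Measure.quasiMeasurePreserving_fst.ae (ae_restrict_mem measurableSet_Ioi)
    filter_upwards [this] with w hw
    rw [norm_mul]
    calc _ ≤ 1 * (C * (decayWeight 2 w.1 * decayWeight 2 w.2)) := by
          gcongr
          · exact norm_exp_neg_mul_le_one hz hw
          · exact h w.1 w.2
      _ = _ := one_mul _

lemma integrable_laplaceSource (hk : IsDecaying k) {z : ℂ} (hz : 0 < z.re) :
    Integrable (laplaceSource k z) :=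
  (integrable_laplaceSource_prod hk hz).integral_prod_right

lemma fourier_laplaceSource (hk : IsDecaying k) {z : ℂ} (hz : 0 < z.re) (η : ℝ) :
    𝓕 (laplaceSource k z) η = ∫ s in Set.Ioi (0 : ℝ), Complex.exp (-z * s) * 𝓕 (k s) η := by
  simp only [fourier_real_eq, laplaceSource, ← integral_const_mul]
  rw [integral_integral_swap]
  · refine integral_congr_ae (.of_forall fun s => integral_congr_ae (.of_forall fun r => ?_))
    ring
  · refine Integrable.swap (f := fun w : ℝ × ℝ => Complex.exp (-2 * Real.pi * w.2 * η * Complex.I) *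
      (Complex.exp (-z * w.1) * k w.1 w.2)) ?_
    refine (integrable_laplaceSource_prod hk hz).bdd_mul (c := 1)
      (Continuous.aestronglyMeasurable (by fun_prop)) (.of_forall fun w => ?_)
    rw [norm_exp_mul_I_eq_one _ (by simp)]

lemma integrable_fourier_laplaceSource (hk : IsDecaying k) {z : ℂ} (hz : 0 < z.re) :
    Integrable (𝓕 (laplaceSource k z)) := by
  obtain ⟨C, hC, h⟩ := hk.fourier_bound 2
  refine integrable_of_le_decayWeight (N := 2) (C := ∫ s in Set.Ioi (0 : ℝ), C * decayWeight 2 s)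
    (continuous_fourier_of_integrable (integrable_laplaceSource hk hz)).aestronglyMeasurable
    (by simp) fun η => ?_
  rw [fourier_laplaceSource hk hz, ← integral_mul_const]
  refine norm_integral_le_of_norm_le
    ((integrable_decayWeight_two.const_mul C).mul_const _).integrableOn ?_
  refine (ae_restrict_iff' measurableSet_Ioi).mpr (.of_forall fun s hs => ?_)
  rw [norm_mul]
  calc _ ≤ 1 * (C * (decayWeight 2 s * decayWeight 2 η)) := by
        gcongr
        · exact norm_exp_neg_mul_le_one hz hs
        · exact h s η
    _ = _ := by ring

/-- Fubini exchanges the Laplace integral with the inverse Fourier integral, after which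
`integral_exp_mul_duhamel` turns the evolution at each `η` into division by `z + iq(η)`. -/
lemma laplace_velocityField (hk : IsDecaying k) {z : ℂ} (hz : 0 < z.re) (r : ℝ) :
    ∫ t in Set.Ioi (0 : ℝ), Complex.exp (-z * t) * velocityField a b c k t r
      = 𝓕⁻ (fun η : ℝ => (2 * Real.pi * (a * η + b) * (-Complex.I) *
          (z + Complex.I * quadratic a b c η)⁻¹ : ℂ) * 𝓕 (laplaceSource k z) η : ℝ → ℂ) r := by
  obtain ⟨C, hC, h⟩ := exists_norm_velocity_duhamel_le a b c hk
  have hexp : IntegrableOn (fun t : ℝ => Complex.exp (-z * t)) (Set.Ioi 0) :=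
    integrableOn_exp_mul_complex_Ioi (by simpa using hz) 0
  simp only [velocityField, fourierInv_real_eq, ← integral_const_mul]
  rw [integral_integral_swap]
  · refine integral_congr_ae (.of_forall fun η => ?_)
    beta_reduce
    have h1 : ∫ t in Set.Ioi (0 : ℝ), Complex.exp (-z * t) * duhamel (quadratic a b c) k t η
        = -Complex.I * ((z + Complex.I * quadratic a b c η)⁻¹ * 𝓕 (laplaceSource k z) η) := by
      rw [fourier_laplaceSource hk hz,
        ← integral_exp_mul_duhamel hz (quadratic a b c η) (hk.integrable_fourier_left η),
        ← integral_const_mul]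
      refine integral_congr_ae (.of_forall fun t => ?_)
      simp only [duhamel]
      ring
    calc _ = ∫ t in Set.Ioi (0 : ℝ), Complex.exp (2 * Real.pi * η * r * Complex.I) *
          (2 * Real.pi * (a * η + b)) *
          (Complex.exp (-z * t) * duhamel (quadratic a b c) k t η) := by
          refine integral_congr_ae (.of_forall fun t => ?_)
          ring
      _ = _ := by
          rw [integral_const_mul, h1]
          ring
  · have hmaj : Integrable (fun w : ℝ × ℝ => ‖Complex.exp (-z * w.1)‖ * (C * decayWeight 2 w.2))
        ((volume.restrict (Set.Ioi 0)).prod volume) :=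
      hexp.norm.mul_prod (integrable_decayWeight_two.const_mul C)
    refine hmaj.mono' ?_ (.of_forall fun w => ?_)
    · exact ((by fun_prop : Continuous fun w : ℝ × ℝ => Complex.exp (-z * w.1)).mul
        ((by fun_prop : Continuous fun w : ℝ × ℝ =>
          Complex.exp (2 * Real.pi * w.2 * r * Complex.I)).mul
        (continuous_velocity_duhamel a b c hk))).aestronglyMeasurable
    · simp only [Function.uncurry]
      rw [norm_mul, norm_mul, norm_exp_mul_I_eq_one _ (by simp), one_mul]
      gcongr
      exact h w.1 w.2

/-- The Laplace transform in time of `velocityField` is bounded in `L^∞` by that of the source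
in `L¹`. -/
lemma norm_laplace_velocityField_le (hk : IsDecaying k) {z : ℂ} (hz : 0 < z.re) (r : ℝ) :
    ‖∫ t in Set.Ioi (0 : ℝ), Complex.exp (-z * t) * velocityField a b c k t r‖
      ≤ ∫ x, ‖laplaceSource k z x‖ := by
  -- Chosen so that `z + iq(η) = 4π²i(aη² + 2bη + c')`. Its imaginary part is `-Re z / 4π²`, hence
  -- nonzero.
  set c' : ℂ := c - Complex.I * z / (4 * Real.pi ^ 2) with hc'
  have hpi := Real.pi_pos
  have hpiC : (Real.pi : ℂ) ≠ 0 := by exact_mod_cast hpi.ne'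
  have him : c'.im ≠ 0 := by
    have : c' = c - ((4 * Real.pi ^ 2)⁻¹ : ℝ) * (Complex.I * z) := by
      rw [hc']; push_cast; field_simp
    rw [this, Complex.sub_im, Complex.im_ofReal_mul]
    simp [hz.ne', hpi.ne']
  have hbound := norm_fourierInv_logDeriv_mul_fourier_le a b him
    (continuous_laplaceSource hk hz) (integrable_laplaceSource hk hz)
    (integrable_fourier_laplaceSource hk hz) r
  rw [laplace_velocityField a b c hk hz]
  -- The prefactor has modulus `1/4π`, which cancels exactly the bound `4π` for the logarithmic
  -- derivative.
  have heq : 𝓕⁻ (fun η : ℝ => (2 * Real.pi * (a * η + b) * (-Complex.I) *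
          (z + Complex.I * quadratic a b c η)⁻¹ : ℂ) * 𝓕 (laplaceSource k z) η : ℝ → ℂ) r
      = -(4 * Real.pi : ℂ)⁻¹ * 𝓕⁻ (fun η : ℝ => (2 * (a * η + b) / (a * η ^ 2 + 2 * b * η + c') : ℂ)
          * 𝓕 (laplaceSource k z) η : ℝ → ℂ) r := by
    simp only [fourierInv_real_eq]
    rw [← integral_const_mul]
    refine integral_congr_ae (.of_forall fun η => ?_)
    beta_reduce
    have h1 : z + Complex.I * quadratic a b c η
        = 4 * Real.pi ^ 2 * Complex.I * (a * η ^ 2 + 2 * b * η + c') := by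
      rw [hc', quadratic]
      push_cast
      field_simp
      linear_combination z * Complex.I_sq
    have h2 : (a * η ^ 2 + 2 * b * η + c' : ℂ) ≠ 0 := by
      intro h0
      apply him
      have : c' = ((-(a * η ^ 2 + 2 * b * η) : ℝ) : ℂ) := by
        push_cast
        linear_combination h0
      rw [this, Complex.ofReal_im]
    rw [h1]
    have hI := Complex.I_ne_zero
    field_simp
  rw [heq, norm_mul, norm_neg, norm_inv]
  have h4 : ‖(4 * Real.pi : ℂ)‖ = 4 * Real.pi := by simp [abs_of_pos hpi]
  rw [h4]
  calc _ ≤ (4 * Real.pi)⁻¹ * (4 * Real.pi * ∫ x, ‖laplaceSource k z x‖) := by gcongr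
    _ = _ := by field_simp

end OneDimensional

/-! ### The estimate on the line, from Laplace bounds to square integrals in time. -/

lemma memLp_two_of_integrable_of_norm_le {α : Type*} [MeasurableSpace α] {μ : Measure α}
    {f : α → ℂ} (hf : Integrable f μ) {C : ℝ} (h : ∀ x, ‖f x‖ ≤ C) : MemLp f 2 μ := by
  rw [memLp_two_iff_integrable_sq_norm hf.1]
  refine (hf.norm.const_mul C).mono' (hf.1.norm.pow 2) (.of_forall fun x => ?_)
  rw [Real.norm_of_nonneg (by positivity), sq]
  gcongr
  exact h x

section OneDimensional

variable {k : ℝ → ℝ → ℂ} (a b c : ℝ)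

/-- The function `f` on the positive half-line, damped by `exp(-δ t)` and extended by zero. -/
def dampedHalf (δ : ℝ) (f : ℝ → ℂ) : ℝ → ℂ :=
  (Set.Ioi 0).indicator fun t : ℝ => Complex.exp (-δ * t) * f t

/-- On the vertical line `Re z = δ` the Laplace transform is a Fourier transform in `t`, to which
Plancherel applies. The damping supplies integrability where only boundedness in `t` is known. -/
lemma fourier_dampedHalf (δ τ : ℝ) (f : ℝ → ℂ) :
    𝓕 (dampedHalf δ f) τ
      = ∫ t in Set.Ioi (0 : ℝ), Complex.exp (-(δ + 2 * Real.pi * τ * Complex.I) * t) * f t := by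
  rw [fourier_real_eq, ← integral_indicator measurableSet_Ioi]
  refine integral_congr_ae (.of_forall fun t => ?_)
  simp only [dampedHalf, Set.indicator_apply]
  split_ifs
  · rw [← mul_assoc, ← Complex.exp_add]
    congr 2
    ring
  · simp

lemma norm_dampedHalf_le {δ : ℝ} (hδ : 0 < δ) (f : ℝ → ℂ) (t : ℝ) :
    ‖dampedHalf δ f t‖ ≤ ‖f t‖ := by
  simp only [dampedHalf, Set.indicator_apply]
  split_ifs with h
  · rw [norm_mul]
    refine mul_le_of_le_one_left (norm_nonneg _) ?_
    exact norm_exp_neg_mul_le_one (z := δ) (by simpa using hδ) h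
  · simp

lemma integrable_dampedHalf {δ : ℝ} (hδ : 0 < δ) {f : ℝ → ℂ} (hf : Continuous f) {C : ℝ}
    (hC : ∀ t, ‖f t‖ ≤ C) : Integrable (dampedHalf δ f) := by
  rw [dampedHalf, integrable_indicator_iff measurableSet_Ioi]
  exact (integrableOn_exp_mul_complex_Ioi (a := -δ) (by simpa using hδ) 0).mul_bdd (c := C)
    hf.aestronglyMeasurable (.of_forall hC)

lemma lintegral_sq_fourier_dampedHalf {δ : ℝ} (hδ : 0 < δ) {f : ℝ → ℂ} (hf : Continuous f) {C : ℝ}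
    (hC : ∀ t, ‖f t‖ ≤ C) :
    ∫⁻ τ, ‖𝓕 (dampedHalf δ f) τ‖ₑ ^ 2 = ∫⁻ t, ‖dampedHalf δ f t‖ₑ ^ 2 :=
  lintegral_sq_fourier_eq (integrable_dampedHalf hδ hf hC)
    (memLp_two_of_integrable_of_norm_le (integrable_dampedHalf hδ hf hC)
      fun t => (norm_dampedHalf_le hδ f t).trans (hC t))

lemma continuous_laplaceSource_prod (hk : IsDecaying k) {δ : ℝ} (hδ : 0 < δ) :
    Continuous fun w : ℝ × ℝ => laplaceSource k (δ + 2 * Real.pi * w.2 * Complex.I) w.1 := by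
  obtain ⟨C, hC, h⟩ := hk.bound 0
  unfold laplaceSource
  refine continuous_of_dominated (bound := fun s => C * decayWeight 2 s) (fun w => ?_)
    (fun w => ?_) (integrable_decayWeight_two.const_mul C).integrableOn (.of_forall fun s => ?_)
  · exact ((by fun_prop : Continuous fun s : ℝ =>
      Complex.exp (-(δ + 2 * Real.pi * w.2 * Complex.I) * s)).mul
      (hk.continuous.uncurry_right w.1)).aestronglyMeasurable
  · refine (ae_restrict_iff' measurableSet_Ioi).mpr (.of_forall fun s hs => ?_)
    rw [norm_mul]
    calc _ ≤ 1 * (C * (decayWeight 2 s * decayWeight 0 w.1)) := by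
          gcongr
          · exact norm_exp_neg_mul_le_one (by simpa using hδ) hs
          · exact h s w.1
      _ = _ := by simp
  · exact (by fun_prop : Continuous fun w : ℝ × ℝ =>
      Complex.exp (-(δ + 2 * Real.pi * w.2 * Complex.I) * s)).mul
      ((hk.continuous_apply s).comp continuous_fst)

/-- The mixed norm `‖k‖_{L¹ₓ L²ₜ}`. -/
def sourceNorm (k : ℝ → ℝ → ℂ) : ℝ≥0∞ := ∫⁻ x, (∫⁻ s, ‖k s x‖ₑ ^ 2) ^ (1 / 2 : ℝ)

/-- Plancherel in `t`, the uniform bound at each `z`, Minkowski to take the `L²` norm in `τ` inside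
the integral over `x`, and Plancherel back for each `x`, where the damping only decreases the
source. The bound does not depend on `δ`. -/
lemma lintegral_sq_dampedHalf_velocityField_le (hk : IsDecaying k) {δ : ℝ} (hδ : 0 < δ) (r : ℝ) :
    ∫⁻ t, ‖dampedHalf δ (fun t => velocityField a b c k t r) t‖ₑ ^ 2 ≤ sourceNorm k ^ 2 := by
  obtain ⟨C, -, hC⟩ := exists_norm_velocityField_le a b c hk
  obtain ⟨C', -, hC'⟩ := hk.bound 0
  have hbdd : ∀ x s, ‖k s x‖ ≤ C' := by
    intro x s
    have h0 : 0 ≤ C' := by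
      have := (norm_nonneg _).trans (hC' 0 0)
      simpa [decayWeight] using this
    refine (hC' s x).trans ?_
    rw [decayWeight_zero_left, mul_one]
    exact mul_le_of_le_one_right h0 (decayWeight_le_one _ _)
  rw [← lintegral_sq_fourier_dampedHalf hδ (continuous_velocityField a b c hk r) (fun t => hC t r)]
  set z : ℝ → ℂ := fun τ => δ + 2 * Real.pi * τ * Complex.I with hz
  have hzre : ∀ τ, 0 < (z τ).re := fun τ => by simpa [hz] using hδ
  calc ∫⁻ τ, ‖𝓕 (dampedHalf δ fun t => velocityField a b c k t r) τ‖ₑ ^ 2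
      ≤ ∫⁻ τ, (∫⁻ x, ‖laplaceSource k (z τ) x‖ₑ) ^ 2 := by
        refine lintegral_mono fun τ => ?_
        gcongr
        rw [fourier_dampedHalf]
        have := norm_laplace_velocityField_le a b c hk (hzre τ) r
        calc _ ≤ ‖∫ x, ‖laplaceSource k (z τ) x‖‖ₑ := by
              refine enorm_le_iff_norm_le.mpr (this.trans (le_abs_self _))
          _ ≤ _ := (enorm_integral_le_lintegral_enorm _).trans_eq (by simp)
    _ ≤ (∫⁻ x, (∫⁻ τ, ‖laplaceSource k (z τ) x‖ₑ ^ 2) ^ (1 / 2 : ℝ)) ^ 2 :=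
        lintegral_sq_lintegral_le (G := fun x τ => ‖laplaceSource k (z τ) x‖ₑ)
          (continuous_laplaceSource_prod hk hδ).enorm.measurable
    _ ≤ sourceNorm k ^ 2 := by
        refine pow_le_pow_left' (lintegral_mono fun x => ENNReal.rpow_le_rpow ?_ (by norm_num)) 2
        have : ∀ τ, laplaceSource k (z τ) x = 𝓕 (dampedHalf δ fun s => k s x) τ := fun τ => by
          rw [fourier_dampedHalf]
          rfl
        simp only [this]
        rw [lintegral_sq_fourier_dampedHalf hδ (hk.continuous.uncurry_right x) (hbdd x)]
        refine lintegral_mono fun s => pow_le_pow_left' ?_ 2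
        exact enorm_le_iff_norm_le.mpr (norm_dampedHalf_le hδ _ s)

/-- Fatou's lemma along `δ = 1/(m + 1)`, using that the damped bound is uniform in `δ`. -/
lemma lintegral_Ioi_sq_velocityField_le (hk : IsDecaying k) (r : ℝ) :
    ∫⁻ t in Set.Ioi 0, ‖velocityField a b c k t r‖ₑ ^ 2 ≤ sourceNorm k ^ 2 := by
  set V : ℝ → ℂ := fun t => velocityField a b c k t r with hV
  have hVc : Continuous V := continuous_velocityField a b c hk r
  set δ : ℕ → ℝ := fun m => 1 / (m + 1) with hδ
  have hδpos : ∀ m, 0 < δ m := fun m => by positivity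
  have hlim : ∀ t ∈ Set.Ioi (0 : ℝ), Filter.Tendsto (fun m => ‖dampedHalf (δ m) V t‖ₑ ^ 2)
      Filter.atTop (nhds (‖V t‖ₑ ^ 2)) := by
    intro t ht
    have h1 : Filter.Tendsto δ Filter.atTop (nhds 0) := tendsto_one_div_add_atTop_nhds_zero_nat
    have h2 : Continuous fun d : ℝ => ‖Complex.exp (-d * t) * V t‖ₑ ^ 2 :=
      (ENNReal.continuous_pow 2).comp (by fun_prop)
    have h3 := (h2.tendsto 0).comp h1
    simp only [Function.comp_def, Complex.ofReal_zero, neg_zero, zero_mul, Complex.exp_zero,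
      one_mul] at h3
    refine h3.congr fun m => ?_
    rw [dampedHalf, Set.indicator_of_mem ht]
  have hmeas : ∀ m, Measurable fun t => ‖dampedHalf (δ m) V t‖ₑ ^ 2 := fun m =>
    (((by fun_prop : Continuous fun t : ℝ => Complex.exp (-(δ m) * t) * V t).measurable.indicator
      measurableSet_Ioi).enorm).pow_const 2
  calc ∫⁻ t in Set.Ioi 0, ‖V t‖ₑ ^ 2
      = ∫⁻ t in Set.Ioi 0, Filter.liminf (fun m => ‖dampedHalf (δ m) V t‖ₑ ^ 2) Filter.atTop :=
        setLIntegral_congr_fun measurableSet_Ioi fun t ht => (hlim t ht).liminf_eq.symm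
    _ ≤ Filter.liminf (fun m => ∫⁻ t in Set.Ioi 0, ‖dampedHalf (δ m) V t‖ₑ ^ 2) Filter.atTop :=
        lintegral_liminf_le hmeas
    _ ≤ sourceNorm k ^ 2 := by
        refine Filter.liminf_le_of_le (by isBoundedDefault) fun B hB => ?_
        obtain ⟨m, hm⟩ := hB.exists
        exact hm.trans ((setLIntegral_le_lintegral _ _).trans
          (lintegral_sq_dampedHalf_velocityField_le a b c hk (hδpos m) r))

lemma velocityField_neg_left (t r : ℝ) :
    velocityField a b c k (-t) r = -velocityField (-a) (-b) (-c) (fun s x => -k (-s) x) t r := by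
  simp only [velocityField, fourierInv_real_eq, duhamel_neg_left]
  rw [← integral_neg]
  have : (fun η => -quadratic a b c η) = quadratic (-a) (-b) (-c) :=
    funext fun η => (quadratic_neg a b c η).symm
  rw [this]
  refine integral_congr_ae (.of_forall fun η => ?_)
  push_cast
  ring

/-- The local smoothing estimate on the line. -/
lemma lintegral_sq_velocityField_le (hk : IsDecaying k) (r : ℝ) :
    ∫⁻ t, ‖velocityField a b c k t r‖ₑ ^ 2 ≤ 2 * sourceNorm k ^ 2 := by
  -- The factor `2` counts the two half-lines of time; the negative one is reflected to the positive
  -- one with all coefficients negated.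
  rw [← lintegral_add_compl _ (measurableSet_Ioi (a := (0 : ℝ))), two_mul]
  refine add_le_add (lintegral_Ioi_sq_velocityField_le a b c hk r) ?_
  have h1 : ∫⁻ t in (Set.Ioi (0 : ℝ))ᶜ, ‖velocityField a b c k t r‖ₑ ^ 2
      = ∫⁻ t in Set.Ioi (0 : ℝ), ‖velocityField a b c k (-t) r‖ₑ ^ 2 := by
    rw [Set.compl_Ioi, setLIntegral_congr Iio_ae_eq_Iic.symm,
      ← (Measure.measurePreserving_neg (volume : Measure ℝ)).setLIntegral_comp_preimage_emb
        (MeasurableEquiv.neg ℝ).measurableEmbedding]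
    simp
  have h2 : sourceNorm (fun s x => -k (-s) x) = sourceNorm k := by
    unfold sourceNorm
    refine lintegral_congr fun x => ?_
    congr 1
    simp only [enorm_neg]
    exact (Measure.measurePreserving_neg (volume : Measure ℝ)).lintegral_comp_emb
      (MeasurableEquiv.neg ℝ).measurableEmbedding fun s => ‖k s x‖ₑ ^ 2
  rw [h1, ← h2]
  simp only [velocityField_neg_left, enorm_neg]
  exact lintegral_Ioi_sq_velocityField_le (-a) (-b) (-c) hk.comp_neg r

end OneDimensional

/-! ### Orthogonal splitting of `ℝⁿ` along `e`. -/

section Splitting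

variable {e : Space n}

/-- The point of `ℝⁿ` with component `r` along `e` and component `v` in the hyperplane. -/
def splitMap (e : Space n) (z : ℝ × hyperplane e) : Space n := z.1 • e + z.2

lemma continuous_splitMap (e : Space n) : Continuous (splitMap e) := by
  unfold splitMap
  fun_prop

/-- The map is a chain of volume-preserving ones: the isometry of `ℝ` with the line spanned by the
unit vector `e`, the passage to the `L²` product, and the inverse orthogonal decomposition. -/
lemma measurePreserving_splitMap (he : ‖e‖ = 1) : MeasurePreserving (splitMap e) := by
  have h1 : MeasurePreserving (Prod.map (LinearIsometryEquiv.toSpanUnitSingleton (𝕜 := ℝ) e he) id :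
      ℝ × hyperplane e → (ℝ ∙ e) × hyperplane e) :=
    (LinearIsometryEquiv.measurePreserving _).prod (MeasurePreserving.id _)
  have h2 := (ℝ ∙ e).orthogonalDecomposition.symm.measurePreserving.comp
    ((WithLp.volume_preserving_toLp (ℝ ∙ e) (hyperplane e)).comp h1)
  convert h2 using 1
  funext z
  simp [splitMap]

lemma splitMap_injective (he : ‖e‖ = 1) : Function.Injective (splitMap e) := by
  intro z w h
  have hinner : ∀ z : ℝ × hyperplane e, inner ℝ e (splitMap e z) = z.1 := fun z => by
    have := Submodule.mem_orthogonal_singleton_iff_inner_right.mp z.2.2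
    rw [splitMap, inner_add_right, this, inner_smul_right, real_inner_self_eq_norm_sq, he]
    simp
  have h1 : z.1 = w.1 := by rw [← hinner z, ← hinner w, h]
  refine Prod.ext h1 (Subtype.ext ?_)
  simpa [splitMap, h1] using h

lemma measurableEmbedding_splitMap (he : ‖e‖ = 1) : MeasurableEmbedding (splitMap e) :=
  (continuous_splitMap e).measurableEmbedding (splitMap_injective he)

lemma inner_splitMap (he : ‖e‖ = 1) (z w : ℝ × hyperplane e) :
    inner ℝ (splitMap e z) (splitMap e w) = z.1 * w.1 + inner ℝ z.2 w.2 := by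
  have h1 := Submodule.mem_orthogonal_singleton_iff_inner_right.mp z.2.2
  have h2 := Submodule.mem_orthogonal_singleton_iff_inner_right.mp w.2.2
  have h3 := Submodule.mem_orthogonal_singleton_iff_inner_left.mp z.2.2
  simp only [splitMap, inner_add_left, inner_add_right, real_inner_smul_left,
    real_inner_smul_right, h2, h3, real_inner_self_eq_norm_sq, he, Submodule.coe_inner]
  ring

lemma norm_sq_splitMap (he : ‖e‖ = 1) (z : ℝ × hyperplane e) :
    ‖splitMap e z‖ ^ 2 = z.1 ^ 2 + ‖z.2‖ ^ 2 := by
  rw [← real_inner_self_eq_norm_sq, inner_splitMap he, real_inner_self_eq_norm_sq]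
  ring

lemma norm_fst_le_norm_splitMap (he : ‖e‖ = 1) (z : ℝ × hyperplane e) : ‖z.1‖ ≤ ‖splitMap e z‖ := by
  refine abs_le_of_sq_le_sq' ?_ (norm_nonneg _) |>.2
  rw [norm_sq_splitMap he, Real.norm_eq_abs, sq_abs]
  nlinarith [sq_nonneg ‖z.2‖]

lemma norm_snd_le_norm_splitMap (he : ‖e‖ = 1) (z : ℝ × hyperplane e) : ‖z.2‖ ≤ ‖splitMap e z‖ := by
  refine abs_le_of_sq_le_sq' ?_ (norm_nonneg _) |>.2
  rw [norm_sq_splitMap he]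
  nlinarith [sq_nonneg z.1]

lemma decayWeight_splitMap_le (he : ‖e‖ = 1) (M N : ℕ) (z : ℝ × hyperplane e) :
    decayWeight (M + N) (splitMap e z) ≤ decayWeight M z.1 * decayWeight N z.2 := by
  rw [decayWeight_add]
  exact mul_le_mul (decayWeight_le_of_norm_le M (norm_fst_le_norm_splitMap he z))
    (decayWeight_le_of_norm_le N (norm_snd_le_norm_splitMap he z))
    (decayWeight_nonneg _ _) (decayWeight_nonneg _ _)

lemma integrable_comp_splitMap (he : ‖e‖ = 1) {G : Space n → ℂ} (hG : Integrable G) :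
    Integrable fun z => G (splitMap e z) :=
  ((measurePreserving_splitMap he).integrable_comp_emb (measurableEmbedding_splitMap he)).mpr hG

lemma fourier_splitMap_eq_integral (he : ‖e‖ = 1) (G : Space n → ℂ) (w : ℝ × hyperplane e) :
    𝓕 G (splitMap e w) = ∫ z : ℝ × hyperplane e,
      Complex.exp (-2 * Real.pi * z.1 * w.1 * Complex.I) *
        (Complex.exp (((-2 * Real.pi * inner ℝ z.2 w.2 : ℝ) : ℂ) * Complex.I) *
          G (splitMap e z)) := by
  rw [Real.fourier_eq', ← (measurePreserving_splitMap he).integral_comp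
    (measurableEmbedding_splitMap he)]
  refine integral_congr_ae (.of_forall fun z => ?_)
  beta_reduce
  rw [inner_splitMap he, smul_eq_mul, ← mul_assoc, ← Complex.exp_add]
  congr 2
  push_cast
  ring

lemma integrable_fourier_splitMap_kernel (he : ‖e‖ = 1) {G : Space n → ℂ} (hG : Integrable G)
    (w : ℝ × hyperplane e) : Integrable fun z : ℝ × hyperplane e =>
      Complex.exp (-2 * Real.pi * z.1 * w.1 * Complex.I) *
        (Complex.exp (((-2 * Real.pi * inner ℝ z.2 w.2 : ℝ) : ℂ) * Complex.I) *
          G (splitMap e z)) := by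
  refine Integrable.bdd_mul (c := 1) (Integrable.bdd_mul (c := 1)
    (integrable_comp_splitMap he hG) (Continuous.aestronglyMeasurable (by fun_prop))
    (.of_forall fun z => ?_)) (Continuous.aestronglyMeasurable (by fun_prop))
    (.of_forall fun z => ?_)
  · rw [Complex.norm_exp_ofReal_mul_I]
  · rw [norm_exp_mul_I_eq_one _ (by simp)]

/-- The Fourier transform as an iterated transform, first in the hyperplane. -/
lemma fourier_splitMap (he : ‖e‖ = 1) {G : Space n → ℂ} (hG : Integrable G)
    (w : ℝ × hyperplane e) :
    𝓕 G (splitMap e w) = 𝓕 (fun r : ℝ => 𝓕 (fun v => G (splitMap e (r, v))) w.2) w.1 := by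
  rw [fourier_splitMap_eq_integral he, Measure.volume_eq_prod,
    integral_prod _ (integrable_fourier_splitMap_kernel he hG w), fourier_real_eq]
  refine integral_congr_ae (.of_forall fun r => ?_)
  dsimp only
  rw [integral_const_mul, Real.fourier_eq']
  rfl

/-- The Fourier transform as an iterated transform, first in the direction `e`. -/
lemma fourier_splitMap_symm (he : ‖e‖ = 1) {G : Space n → ℂ} (hG : Integrable G)
    (w : ℝ × hyperplane e) :
    𝓕 G (splitMap e w) = 𝓕 (fun v => 𝓕 (fun r : ℝ => G (splitMap e (r, v))) w.1) w.2 := by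
  rw [fourier_splitMap_eq_integral he, Measure.volume_eq_prod,
    integral_prod_symm _ (integrable_fourier_splitMap_kernel he hG w), Real.fourier_eq']
  refine integral_congr_ae (.of_forall fun v => ?_)
  beta_reduce
  rw [fourier_real_eq, smul_eq_mul, ← integral_const_mul]
  refine integral_congr_ae (.of_forall fun r => ?_)
  ring

lemma fourierInv_splitMap_symm (he : ‖e‖ = 1) {G : Space n → ℂ} (hG : Integrable G)
    (w : ℝ × hyperplane e) :
    𝓕⁻ G (splitMap e w) = 𝓕⁻ (fun v => 𝓕⁻ (fun r : ℝ => G (splitMap e (r, v))) w.1) w.2 := by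
  simp only [Real.fourierInv_eq_fourier_neg]
  have : -splitMap e w = splitMap e (-w) := by simp [splitMap]; abel
  rw [this, fourier_splitMap_symm he hG]
  simp

end Splitting

/-! ### The source transformed in the hyperplane variable. -/

section Slices

variable {e : Space n} {F : ℝ → Space n → ℂ}

/-- The Fourier transform of `F` in the hyperplane variable, as a function on the line. -/
def slice (e : Space n) (F : ℝ → Space n → ℂ) (ζ : hyperplane e) (s r : ℝ) : ℂ :=
  𝓕 (fun v : hyperplane e => F s (splitMap e (r, v))) ζ

lemma finrank_hyperplane_lt (e : Space n) : Module.finrank ℝ (hyperplane e) < n + 1 := by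
  have := Submodule.finrank_le (hyperplane e)
  simp only [finrank_euclideanSpace, Fintype.card_fin] at this
  omega

/-- The exponent `n + 1` exceeds the dimension of the hyperplane, so the last weight is integrable
in `v`, while `N` remains free in the direction of `e`. -/
lemma IsDecaying.exists_norm_comp_splitMap_le (hF : IsDecaying F) (he : ‖e‖ = 1) (N : ℕ) :
    ∃ C : ℝ, 0 ≤ C ∧ ∀ s (z : ℝ × hyperplane e), ‖F s (splitMap e z)‖
      ≤ C * (decayWeight 2 s * decayWeight N z.1 * decayWeight (n + 1) z.2) := by
  obtain ⟨C, hC, h⟩ := hF.bound (N + (n + 1))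
  refine ⟨C, hC, fun s z => (h _ _).trans ?_⟩
  rw [mul_assoc (decayWeight 2 s)]
  gcongr
  · exact decayWeight_nonneg _ _
  · exact decayWeight_splitMap_le he N (n + 1) z

lemma continuous_slice (hF : IsDecaying F) (he : ‖e‖ = 1) :
    Continuous fun w : hyperplane e × ℝ × ℝ => slice e F w.1 w.2.1 w.2.2 := by
  obtain ⟨C, hC, h⟩ := hF.exists_norm_comp_splitMap_le he 0
  have hFs : Continuous fun w : ℝ × ℝ × hyperplane e => F w.1 (splitMap e w.2) :=
    hF.continuous.comp (continuous_fst.prodMk ((continuous_splitMap e).comp continuous_snd))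
  simp only [slice, Real.fourier_eq']
  refine continuous_of_dominated (bound := fun v => C * decayWeight (n + 1) v)
    (fun w => ?_) (fun w => .of_forall fun v => ?_)
    ((integrable_decayWeight (finrank_hyperplane_lt e)).const_mul C) (.of_forall fun v => ?_)
  · have h1 : Continuous fun v : hyperplane e => F w.2.1 (splitMap e (w.2.2, v)) :=
      hFs.comp (by fun_prop : Continuous fun v : hyperplane e => (w.2.1, w.2.2, v))
    have h2 : Continuous fun v : hyperplane e =>
        Complex.exp (((-2 * Real.pi * inner ℝ v w.1 : ℝ) : ℂ) * Complex.I) := by fun_prop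
    exact (h2.smul h1).aestronglyMeasurable
  · rw [norm_smul, Complex.norm_exp_ofReal_mul_I, one_mul]
    refine (h _ _).trans ?_
    rw [decayWeight_zero_left, mul_one]
    gcongr
    exact mul_le_of_le_one_left (decayWeight_nonneg _ _) (decayWeight_le_one _ _)
  · have h1 : Continuous fun w : hyperplane e × ℝ × ℝ => F w.2.1 (splitMap e (w.2.2, v)) :=
      hFs.comp (by fun_prop : Continuous fun w : hyperplane e × ℝ × ℝ => (w.2.1, w.2.2, v))
    have h2 : Continuous fun w : hyperplane e × ℝ × ℝ =>
        Complex.exp (((-2 * Real.pi * inner ℝ v w.1 : ℝ) : ℂ) * Complex.I) := by fun_prop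
    exact h2.smul h1

lemma fourier_slice (hF : IsDecaying F) (he : ‖e‖ = 1) (ζ : hyperplane e) (s η : ℝ) :
    𝓕 (slice e F ζ s) η = 𝓕 (F s) (splitMap e (η, ζ)) := by
  rw [fourier_splitMap he (hF.integrable_apply s) (η, ζ)]
  rfl

lemma exists_norm_slice_le (hF : IsDecaying F) (he : ‖e‖ = 1) (N : ℕ) :
    ∃ C : ℝ, 0 ≤ C ∧ ∀ ζ s r, ‖slice e F ζ s r‖ ≤ C * (decayWeight 2 s * decayWeight N r) := by
  obtain ⟨C, hC, h⟩ := hF.exists_norm_comp_splitMap_le he N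
  have hi : Integrable (decayWeight (n + 1) : hyperplane e → ℝ) :=
    integrable_decayWeight (finrank_hyperplane_lt e)
  refine ⟨C * ∫ v : hyperplane e, decayWeight (n + 1) v,
    mul_nonneg hC (integral_nonneg fun v => decayWeight_nonneg _ _), fun ζ s r => ?_⟩
  have h1 : C * (∫ v : hyperplane e, decayWeight (n + 1) v) * (decayWeight 2 s * decayWeight N r)
      = ∫ v : hyperplane e, C * (decayWeight 2 s * decayWeight N r) * decayWeight (n + 1) v := by
    rw [integral_const_mul]
    ring
  rw [slice, Real.fourier_eq', h1]
  refine norm_integral_le_of_norm_le (hi.const_mul _) (.of_forall fun v => ?_)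
  rw [norm_smul, Complex.norm_exp_ofReal_mul_I, one_mul, mul_assoc]
  exact h s (r, v)

/-- The frequency decay is read off from the full transform of `F` restricted to the line `ηe + ζ`,
since `|η|` is at most the norm of that point. Slices are thus admissible sources on the line,
without being shown to be Schwartz. -/
lemma isDecaying_slice (hF : IsDecaying F) (he : ‖e‖ = 1) (ζ : hyperplane e) :
    IsDecaying (slice e F ζ) where
  continuous := by
    have h1 : Continuous fun z : ℝ × ℝ => (ζ, z) := by fun_prop
    have h2 := (continuous_slice hF he).comp h1
    exact h2
  bound N := by
    obtain ⟨C, hC, h⟩ := exists_norm_slice_le hF he N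
    exact ⟨C, hC, h ζ⟩
  fourier_bound N := by
    obtain ⟨C, hC, h⟩ := hF.fourier_bound N
    refine ⟨C, hC, fun s η => ?_⟩
    have h1 := h s (splitMap e (η, ζ))
    have h2 := decayWeight_le_of_norm_le N (norm_fst_le_norm_splitMap he (η, ζ))
    have h3 := mul_le_mul_of_nonneg_left h2 (decayWeight_nonneg 2 s)
    exact (congrArg norm (fourier_slice hF he ζ s η)).trans_le
      (h1.trans (mul_le_mul_of_nonneg_left h3 hC))

lemma lintegral_sq_slice (hF : IsDecaying F) (he : ‖e‖ = 1) (s r : ℝ) :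
    ∫⁻ ζ, ‖slice e F ζ s r‖ₑ ^ 2 = ∫⁻ v : hyperplane e, ‖F s (splitMap e (r, v))‖ₑ ^ 2 := by
  obtain ⟨C, hC, h⟩ := hF.exists_norm_comp_splitMap_le he 0
  have hcont : Continuous fun v : hyperplane e => F s (splitMap e (r, v)) :=
    (hF.continuous_apply s).comp ((continuous_splitMap e).comp (Continuous.prodMk_right r))
  have hb : ∀ v : hyperplane e, ‖F s (splitMap e (r, v))‖
      ≤ C * decayWeight 2 s * decayWeight (n + 1) v := fun v => by
    refine (h s (r, v)).trans_eq ?_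
    rw [decayWeight_zero_left]
    ring
  exact lintegral_sq_fourier_eq
    (integrable_of_le_decayWeight hcont.aestronglyMeasurable (finrank_hyperplane_lt e) hb)
    (memLp_of_le_decayWeight hcont.aestronglyMeasurable (finrank_hyperplane_lt e) hb)

end Slices

/-! ### The function representing `D_a u`. -/

section Representation

variable {F : ℝ → Space n → ℂ}

/-- The Fourier transform in `x` of `D_a u`, where `u` is the Duhamel solution. -/
def derivativeSymbol (ε : Fin n → ℝ) (a : Space n) (F : ℝ → Space n → ℂ) (t : ℝ) (ξ : Space n) :
    ℂ :=
  ((2 * Real.pi * inner ℝ ξ a : ℝ) : ℂ) * duhamel (symbol ε) F t ξ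

/-- The function `D_a u`, where `u` is the Duhamel solution. -/
def derivativeField (ε : Fin n → ℝ) (a : Space n) (F : ℝ → Space n → ℂ) (t : ℝ) (x : Space n) :
    ℂ :=
  𝓕⁻ (derivativeSymbol ε a F t) x

lemma continuous_derivativeSymbol (ε : Fin n → ℝ) (a : Space n) (hF : IsDecaying F) :
    Continuous fun z : ℝ × Space n => derivativeSymbol ε a F z.1 z.2 := by
  have h1 : Continuous fun z : ℝ × Space n => ((2 * Real.pi * inner ℝ z.2 a : ℝ) : ℂ) := by
    fun_prop
  exact h1.mul (continuous_duhamel hF (continuous_symbol ε))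

lemma continuous_derivativeSymbol_right (ε : Fin n → ℝ) (a : Space n) (hF : IsDecaying F) (t : ℝ) :
    Continuous (derivativeSymbol ε a F t) := by
  have h1 : Continuous fun ξ : Space n => ((2 * Real.pi * inner ℝ ξ a : ℝ) : ℂ) := by
    fun_prop
  exact h1.mul (continuous_duhamel_right hF (continuous_symbol ε) t)

lemma exists_norm_derivativeSymbol_le (ε : Fin n → ℝ) (a : Space n) (hF : IsDecaying F) (N : ℕ) :
    ∃ C : ℝ, 0 ≤ C ∧ ∀ t ξ, ‖derivativeSymbol ε a F t ξ‖ ≤ C * decayWeight N ξ := by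
  obtain ⟨C, hC, h⟩ := exists_norm_duhamel_le (symbol ε) hF (1 + N)
  refine ⟨2 * Real.pi * ‖a‖ * C, by positivity, fun t ξ => ?_⟩
  have h1 : ‖((2 * Real.pi * inner ℝ ξ a : ℝ) : ℂ)‖ ≤ 2 * Real.pi * ‖a‖ * (1 + ‖ξ‖) ^ 1 := by
    rw [Complex.norm_real, Real.norm_eq_abs, abs_mul, abs_of_pos (by positivity), pow_one,
      mul_assoc (2 * Real.pi)]
    gcongr
    calc |inner ℝ ξ a| ≤ ‖ξ‖ * ‖a‖ := abs_real_inner_le_norm _ _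
      _ ≤ ‖a‖ * (1 + ‖ξ‖) := by nlinarith [norm_nonneg a]
  rw [derivativeSymbol, norm_mul]
  calc _ ≤ 2 * Real.pi * ‖a‖ * (1 + ‖ξ‖) ^ 1 * (C * decayWeight (1 + N) ξ) := by
        gcongr
        exact h t ξ
    _ = 2 * Real.pi * ‖a‖ * C * ((1 + ‖ξ‖) ^ 1 * decayWeight (1 + N) ξ) := by ring
    _ ≤ _ := by
        gcongr
        exact pow_mul_decayWeight_le 1 N ξ

lemma integrable_derivativeSymbol (ε : Fin n → ℝ) (a : Space n) (hF : IsDecaying F) (t : ℝ) :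
    Integrable (derivativeSymbol ε a F t) := by
  obtain ⟨C, -, h⟩ := exists_norm_derivativeSymbol_le ε a hF (Module.finrank ℝ (Space n) + 1)
  exact integrable_of_le_decayWeight
    (continuous_derivativeSymbol_right ε a hF t).aestronglyMeasurable (Nat.lt_succ_self _) (h t)

lemma memLp_derivativeSymbol (ε : Fin n → ℝ) (a : Space n) (hF : IsDecaying F) (t : ℝ) :
    MemLp (derivativeSymbol ε a F t) 2 := by
  obtain ⟨C, -, h⟩ := exists_norm_derivativeSymbol_le ε a hF (Module.finrank ℝ (Space n) + 1)
  exact memLp_of_le_decayWeight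
    (continuous_derivativeSymbol_right ε a hF t).aestronglyMeasurable (Nat.lt_succ_self _) (h t)

lemma continuous_derivativeField (ε : Fin n → ℝ) (a : Space n) (hF : IsDecaying F) :
    Continuous fun z : ℝ × Space n => derivativeField ε a F z.1 z.2 := by
  obtain ⟨C, hC, h⟩ := exists_norm_derivativeSymbol_le ε a hF (Module.finrank ℝ (Space n) + 1)
  simp only [derivativeField, Real.fourierInv_eq']
  refine continuous_of_dominated
    (bound := fun ξ => C * decayWeight (Module.finrank ℝ (Space n) + 1) ξ)
    (fun z => ?_) (fun z => .of_forall fun ξ => ?_)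
    ((integrable_decayWeight (Nat.lt_succ_self _)).const_mul C) (.of_forall fun ξ => ?_)
  · have h1 : Continuous fun ξ : Space n =>
        Complex.exp (((2 * Real.pi * inner ℝ ξ z.2 : ℝ) : ℂ) * Complex.I) := by fun_prop
    exact (h1.smul (continuous_derivativeSymbol_right ε a hF z.1)).aestronglyMeasurable
  · rw [norm_smul, Complex.norm_exp_ofReal_mul_I, one_mul]
    exact h _ _
  · have h1 : Continuous fun z : ℝ × Space n =>
        Complex.exp (((2 * Real.pi * inner ℝ ξ z.2 : ℝ) : ℂ) * Complex.I) := by fun_prop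
    have h2 : Continuous fun z : ℝ × Space n => (z.1, ξ) := by fun_prop
    have h3 := (continuous_derivativeSymbol ε a hF).comp h2
    exact h1.smul h3

lemma hasTemperateGrowth_inner (a : Space n) :
    Function.HasTemperateGrowth fun ξ : Space n => ((2 * Real.pi * inner ℝ ξ a : ℝ) : ℂ) := by
  have h : (fun ξ : Space n => 2 * Real.pi * inner ℝ ξ a).HasTemperateGrowth := by fun_prop
  exact Complex.ofRealCLM.hasTemperateGrowth.comp h

/-- The multiplier acts on the test function by duality, is moved onto the transform of the
solution, and the self-adjointness of the inverse Fourier integral returns the pairing to physical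
space. -/
lemma directionalD_solution_apply (ε : Fin n → ℝ) (a : Space n) (hF : IsDecaying F) (t : ℝ)
    (φ : 𝓢(Space n, ℂ)) :
    directionalD a (Lp.toTemperedDistribution (solution ε hF t)) φ
      = ∫ x, φ x * derivativeField ε a F t x := by
  set ψ : 𝓢(Space n, ℂ) := SchwartzMap.smulLeftCLM ℂ
    (fun ξ : Space n => ((2 * Real.pi * inner ℝ ξ a : ℝ) : ℂ)) (𝓕⁻ φ) with hψ
  have h1 : directionalD a (Lp.toTemperedDistribution (solution ε hF t)) φ
      = Lp.toTemperedDistribution (solution ε hF t) (𝓕 ψ) := by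
    rw [directionalD, TemperedDistribution.fourierMultiplierCLM_apply_apply]
  rw [h1, toTemperedDistribution_solution_apply, FourierTransform.fourierInv_fourier_eq]
  have h2 := integral_fourierInv_mul_comm φ.integrable (integrable_derivativeSymbol ε a hF t)
  refine Eq.trans (integral_congr_ae (.of_forall fun ξ => ?_)) h2
  beta_reduce
  rw [hψ, SchwartzMap.smulLeftCLM_apply_apply (hasTemperateGrowth_inner a), smul_eq_mul,
    derivativeSymbol, SchwartzMap.fourierInv_coe]
  ring

lemma isRepresentedBy_derivativeField (ε : Fin n → ℝ) (a : Space n) (hF : IsDecaying F) :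
    IsRepresentedBy (fun t => directionalD a (Lp.toTemperedDistribution (solution ε hF t)))
      (derivativeField ε a F) where
  aestronglyMeasurable := (continuous_derivativeField ε a hF).aestronglyMeasurable
  memLp t := memLp_fourierInv (integrable_derivativeSymbol ε a hF t)
    (memLp_derivativeSymbol ε a hF t)
  pairing t φ := directionalD_solution_apply ε a hF t φ

end Representation

/-! ### The smoothing estimate in all dimensions. -/

section Estimate

variable {F : ℝ → Space n → ℂ} (ε : Fin n → ℝ) {e : Space n}

lemma symbol_splitMap (η : ℝ) (ζ : hyperplane e) :
    symbol ε (splitMap e (η, ζ)) = quadratic (∑ i, ε i * e i ^ 2)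
      (∑ i, ε i * e i * (ζ : Space n) i) (∑ i, ε i * (ζ : Space n) i ^ 2) η := by
  simp only [symbol, splitMap, quadratic, PiLp.add_apply, PiLp.smul_apply, smul_eq_mul,
    Finset.sum_mul, Finset.mul_sum, ← Finset.sum_add_distrib]
  refine Finset.sum_congr rfl fun i _ => ?_
  ring

/-- The coefficients are those of `symbol_splitMap`: the signed vector is what makes the multiplier
proportional to the derivative of the symbol in the direction `e`, and so yields a logarithmic
derivative. -/
lemma inner_splitMap_signedVector (η : ℝ) (ζ : hyperplane e) :
    inner ℝ (splitMap e (η, ζ)) (signedVector ε e)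
      = (∑ i, ε i * e i ^ 2) * η + ∑ i, ε i * e i * (ζ : Space n) i := by
  simp only [splitMap, signedVector, PiLp.inner_apply, PiLp.add_apply, PiLp.smul_apply,
    smul_eq_mul, Finset.sum_mul, ← Finset.sum_add_distrib]
  refine Finset.sum_congr rfl fun i _ => ?_
  simp
  ring

lemma duhamel_splitMap (hF : IsDecaying F) (he : ‖e‖ = 1) (t η : ℝ) (ζ : hyperplane e) :
    duhamel (symbol ε) F t (splitMap e (η, ζ))
      = duhamel (quadratic (∑ i, ε i * e i ^ 2) (∑ i, ε i * e i * (ζ : Space n) i)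
        (∑ i, ε i * (ζ : Space n) i ^ 2)) (slice e F ζ) t η := by
  simp only [duhamel, fourier_slice hF he, symbol_splitMap]

/-- The Fourier transform of `D_{e_±} u` in the hyperplane variable. -/
def fieldSlice (ε : Fin n → ℝ) (e : Space n) (F : ℝ → Space n → ℂ) (t r : ℝ) (ζ : hyperplane e) :
    ℂ :=
  𝓕⁻ (fun η : ℝ => derivativeSymbol ε (signedVector ε e) F t (splitMap e (η, ζ))) r

lemma fieldSlice_eq_velocityField (hF : IsDecaying F) (he : ‖e‖ = 1) (t r : ℝ)
    (ζ : hyperplane e) :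
    fieldSlice ε e F t r ζ = velocityField (∑ i, ε i * e i ^ 2)
      (∑ i, ε i * e i * (ζ : Space n) i) (∑ i, ε i * (ζ : Space n) i ^ 2) (slice e F ζ) t r := by
  rw [fieldSlice, velocityField]
  refine congrArg (fun f : ℝ → ℂ => 𝓕⁻ f r) (funext fun η => ?_)
  rw [derivativeSymbol, duhamel_splitMap ε hF he, inner_splitMap_signedVector]
  push_cast
  rfl

lemma exists_norm_derivativeSymbol_splitMap_le (hF : IsDecaying F) (he : ‖e‖ = 1) :
    ∃ C : ℝ, 0 ≤ C ∧ ∀ t η (ζ : hyperplane e),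
      ‖derivativeSymbol ε (signedVector ε e) F t (splitMap e (η, ζ))‖
        ≤ C * (decayWeight 2 η * decayWeight (n + 1) ζ) := by
  obtain ⟨C, hC, h⟩ := exists_norm_derivativeSymbol_le ε (signedVector ε e) hF (2 + (n + 1))
  refine ⟨C, hC, fun t η ζ => (h t _).trans ?_⟩
  exact mul_le_mul_of_nonneg_left (decayWeight_splitMap_le he 2 (n + 1) (η, ζ)) hC

lemma continuous_fieldSlice (hF : IsDecaying F) (he : ‖e‖ = 1) (r : ℝ) :
    Continuous fun w : ℝ × hyperplane e => fieldSlice ε e F w.1 r w.2 := by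
  obtain ⟨C, hC, h⟩ := exists_norm_derivativeSymbol_splitMap_le ε hF he
  have hcont : Continuous fun w : ℝ × ℝ × hyperplane e =>
      derivativeSymbol ε (signedVector ε e) F w.1 (splitMap e w.2) := by
    have h1 : Continuous fun w : ℝ × ℝ × hyperplane e => (w.1, splitMap e w.2) :=
      continuous_fst.prodMk ((continuous_splitMap e).comp continuous_snd)
    have h2 := (continuous_derivativeSymbol ε (signedVector ε e) hF).comp h1
    exact h2
  simp only [fieldSlice, fourierInv_real_eq]
  refine continuous_of_dominated (bound := fun η => C * decayWeight 2 η)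
    (fun w => ?_) (fun w => .of_forall fun η => ?_)
    (integrable_decayWeight_two.const_mul C) (.of_forall fun η => ?_)
  · have h1 : Continuous fun η : ℝ => (w.1, η, w.2) := by fun_prop
    have h2 := hcont.comp h1
    have h3 : Continuous fun η : ℝ => Complex.exp (2 * Real.pi * η * r * Complex.I) := by fun_prop
    exact (h3.mul h2).aestronglyMeasurable
  · rw [norm_mul, norm_exp_mul_I_eq_one _ (by simp), one_mul]
    refine (h _ _ _).trans ?_
    gcongr
    exact mul_le_of_le_one_right (decayWeight_nonneg _ _) (decayWeight_le_one _ _)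
  · have h1 : Continuous fun w : ℝ × hyperplane e => (w.1, η, w.2) := by fun_prop
    have h2 := hcont.comp h1
    exact continuous_const.mul h2

lemma exists_norm_fieldSlice_le (hF : IsDecaying F) (he : ‖e‖ = 1) :
    ∃ C : ℝ, ∀ t r (ζ : hyperplane e), ‖fieldSlice ε e F t r ζ‖ ≤ C * decayWeight (n + 1) ζ := by
  obtain ⟨C, -, h⟩ := exists_norm_derivativeSymbol_splitMap_le ε hF he
  refine ⟨∫ η : ℝ, C * decayWeight 2 η, fun t r ζ => ?_⟩
  rw [fieldSlice, fourierInv_real_eq, ← integral_mul_const]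
  refine norm_integral_le_of_norm_le ((integrable_decayWeight_two.const_mul C).mul_const _)
    (.of_forall fun η => ?_)
  rw [norm_mul, norm_exp_mul_I_eq_one _ (by simp), one_mul, mul_assoc]
  exact h t η ζ

lemma lintegral_sq_derivativeField (hF : IsDecaying F) (he : ‖e‖ = 1) (t r : ℝ) :
    ∫⁻ v : hyperplane e, ‖derivativeField ε (signedVector ε e) F t (splitMap e (r, v))‖ₑ ^ 2
      = ∫⁻ ζ, ‖fieldSlice ε e F t r ζ‖ₑ ^ 2 := by
  obtain ⟨C, h⟩ := exists_norm_fieldSlice_le ε hF he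
  have h1 : Continuous fun ζ : hyperplane e => (t, ζ) := by fun_prop
  have hcont := (continuous_fieldSlice ε hF he r).comp h1
  have heq : ∀ v : hyperplane e, derivativeField ε (signedVector ε e) F t (splitMap e (r, v))
      = 𝓕⁻ (fieldSlice ε e F t r) v := fun v =>
    fourierInv_splitMap_symm he (integrable_derivativeSymbol ε (signedVector ε e) hF t) (r, v)
  simp only [heq]
  exact lintegral_sq_fourierInv_eq
    (integrable_of_le_decayWeight hcont.aestronglyMeasurable (finrank_hyperplane_lt e) (h t r))
    (memLp_of_le_decayWeight hcont.aestronglyMeasurable (finrank_hyperplane_lt e) (h t r))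

/-- A second use of Minkowski exchanges `L²` in `ζ` with `L¹` in `x`; Plancherel in the hyperplane
then restores `F`. -/
lemma lintegral_sq_sourceNorm_slice_le (hF : IsDecaying F) (he : ‖e‖ = 1) :
    ∫⁻ ζ, sourceNorm (slice e F ζ) ^ 2
      ≤ (∫⁻ x : ℝ, (∫⁻ s : ℝ, ∫⁻ v : hyperplane e,
          ‖F s (splitMap e (x, v))‖ₑ ^ 2) ^ (1 / 2 : ℝ)) ^ 2 := by
  have hm : Measurable fun w : hyperplane e × ℝ × ℝ => ‖slice e F w.1 w.2.1 w.2.2‖ₑ ^ 2 :=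
    (continuous_slice hF he).enorm.measurable.pow_const 2
  have hG : Measurable (Function.uncurry fun (x : ℝ) (ζ : hyperplane e) =>
      (∫⁻ s, ‖slice e F ζ s x‖ₑ ^ 2) ^ (1 / 2 : ℝ)) := by
    have h1 : Measurable fun w : (ℝ × hyperplane e) × ℝ => (w.1.2, w.2, w.1.1) := by fun_prop
    have h2 := hm.comp h1
    exact h2.lintegral_prod_right'.pow_const _
  refine (lintegral_sq_lintegral_le hG).trans_eq ?_
  congr 1
  refine lintegral_congr fun x => ?_
  congr 1
  calc ∫⁻ ζ, ((∫⁻ s, ‖slice e F ζ s x‖ₑ ^ 2) ^ (1 / 2 : ℝ)) ^ 2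
      = ∫⁻ ζ, ∫⁻ s, ‖slice e F ζ s x‖ₑ ^ 2 := by
        refine lintegral_congr fun ζ => ?_
        rw [← ENNReal.rpow_natCast, ← ENNReal.rpow_mul]
        norm_num
    _ = ∫⁻ s, ∫⁻ ζ, ‖slice e F ζ s x‖ₑ ^ 2 := by
        refine lintegral_lintegral_swap ?_
        have h1 : Measurable fun w : hyperplane e × ℝ => (w.1, w.2, x) := by fun_prop
        have h2 := hm.comp h1
        exact h2.aemeasurable
    _ = _ := lintegral_congr fun s => lintegral_sq_slice hF he s x

/-- Plancherel in `v` at each time, then Tonelli, so that the estimate on the line applies for each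
fixed `ζ` with a constant independent of `ζ`. -/
lemma lintegral_lintegral_sq_derivativeField_le (hF : IsDecaying F) (he : ‖e‖ = 1) (r : ℝ) :
    ∫⁻ t : ℝ, ∫⁻ v : hyperplane e,
        ‖derivativeField ε (signedVector ε e) F t (splitMap e (r, v))‖ₑ ^ 2
      ≤ 2 * (∫⁻ x : ℝ, (∫⁻ s : ℝ, ∫⁻ v : hyperplane e,
          ‖F s (splitMap e (x, v))‖ₑ ^ 2) ^ (1 / 2 : ℝ)) ^ 2 := by
  calc _ = ∫⁻ t, ∫⁻ ζ, ‖fieldSlice ε e F t r ζ‖ₑ ^ 2 :=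
        lintegral_congr fun t => lintegral_sq_derivativeField ε hF he t r
    _ = ∫⁻ ζ, ∫⁻ t, ‖fieldSlice ε e F t r ζ‖ₑ ^ 2 :=
        lintegral_lintegral_swap
          ((continuous_fieldSlice ε hF he r).enorm.measurable.pow_const 2).aemeasurable
    _ ≤ ∫⁻ ζ, 2 * sourceNorm (slice e F ζ) ^ 2 := by
        refine lintegral_mono fun ζ => ?_
        simp only [fieldSlice_eq_velocityField ε hF he]
        exact lintegral_sq_velocityField_le _ _ _ (isDecaying_slice hF he ζ) r
    _ = 2 * ∫⁻ ζ, sourceNorm (slice e F ζ) ^ 2 := lintegral_const_mul' _ _ (by simp)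
    _ ≤ _ := by
        gcongr
        exact lintegral_sq_sourceNorm_slice_le hF he

lemma eLpNorm_two_sq_splitMap {G : ℝ → Space n → ℂ} (hG : Continuous (Function.uncurry G))
    (r : ℝ) :
    eLpNorm (fun z : ℝ × hyperplane e => G z.1 (r • e + (z.2 : Space n))) 2 volume ^ 2
      = ∫⁻ t : ℝ, ∫⁻ v : hyperplane e, ‖G t (splitMap e (r, v))‖ₑ ^ 2 := by
  have h1 : Continuous fun z : ℝ × hyperplane e => (z.1, r • e + (z.2 : Space n)) := by fun_prop
  have h2 := hG.comp h1
  rw [eLpNorm_two_sq, Measure.volume_eq_prod]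
  exact lintegral_prod _ (h2.enorm.measurable.pow_const 2).aemeasurable

/-- The local smoothing estimate for the Duhamel solution. -/
lemma directionalNorm_derivativeField_le (hF : IsDecaying F) (he : ‖e‖ = 1) :
    directionalNorm e ∞ 2 (derivativeField ε (signedVector ε e) F)
      ≤ 2 * directionalNorm e 1 2 F := by
  have hsource : directionalNorm e 1 2 F = ∫⁻ x : ℝ, (∫⁻ s : ℝ, ∫⁻ v : hyperplane e,
      ‖F s (splitMap e (x, v))‖ₑ ^ 2) ^ (1 / 2 : ℝ) := by
    rw [directionalNorm, eLpNorm_one_eq_lintegral_enorm]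
    refine lintegral_congr fun x => ?_
    rw [← eLpNorm_two_sq_splitMap hF.continuous, ← ENNReal.rpow_natCast, ← ENNReal.rpow_mul]
    norm_num
  rw [directionalNorm, eLpNorm_exponent_top]
  refine eLpNormEssSup_le_of_ae_enorm_bound (.of_forall fun r => ?_)
  -- Norms are compared through their squares.
  rw [enorm_eq_self, ← (ENNReal.pow_right_strictMono two_ne_zero).le_iff_le,
    eLpNorm_two_sq_splitMap (continuous_derivativeField ε (signedVector ε e) hF), hsource]
  refine (lintegral_lintegral_sq_derivativeField_le ε hF he r).trans ?_
  rw [mul_pow]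
  gcongr
  -- The squared estimate has constant `2`, which is relaxed to `2 ^ 2` to avoid a square root.
  exact le_self_pow₀ (by norm_num) two_ne_zero

end Estimate

end NonEllipticSchrodinger

end

theorem lemma2p5 (n : ℕ) :
    ∃ C : ℝ≥0, ∀ ε : Fin n → ℝ, (∀ i, ε i = 1 ∨ ε i = -1) →
      ∀ F : 𝓢(ℝ × NonEllipticSchrodinger.Space n, ℂ),
        (∃! u : ℝ → Lp ℂ 2 (volume : Measure (NonEllipticSchrodinger.Space n)),
          NonEllipticSchrodinger.IsSolution ε F u) ∧
        ∀ u : ℝ → Lp ℂ 2 (volume : Measure (NonEllipticSchrodinger.Space n)),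
          NonEllipticSchrodinger.IsSolution ε F u →
          ∀ e : NonEllipticSchrodinger.Space n, ‖e‖ = 1 →
            ∃ Du : ℝ → NonEllipticSchrodinger.Space n → ℂ,
              NonEllipticSchrodinger.IsRepresentedBy
                (fun t : ℝ => NonEllipticSchrodinger.directionalD
                  (NonEllipticSchrodinger.signedVector ε e) (Lp.toTemperedDistribution (u t)))
                Du ∧
              NonEllipticSchrodinger.directionalNorm e ∞ 2 Du
                ≤ C * NonEllipticSchrodinger.directionalNorm e 1 2 (fun t x => F (t, x)) := by
  refine ⟨2, fun ε _ F => ?_⟩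
  have hF := NonEllipticSchrodinger.isDecaying_of_schwartz F
  have hsol : NonEllipticSchrodinger.IsSolution ε F
      (NonEllipticSchrodinger.solution ε hF) :=
    NonEllipticSchrodinger.isSolution_solution ε F
  refine ⟨⟨_, hsol, fun v hv => hv.unique hsol⟩, fun u hu e he => ?_⟩
  -- By uniqueness it suffices to treat the Duhamel solution, for which the field is explicit.
  rw [hu.unique hsol]
  exact ⟨_, NonEllipticSchrodinger.isRepresentedBy_derivativeField ε _ hF,
    NonEllipticSchrodinger.directionalNorm_derivativeField_le ε hF he⟩
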